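/- **Stable marriage with unacceptability and ties.** Let $n,p\ge 1$, men $m_1,\dots,m_n$, women $w_1,\dots,w_p$. In an instance $(S_M,S_W)$ every man $m_i$ has a nonempty list $\sigma_M^i=(\sigma_M^i(1),\dots,\sigma_M^i(|\sigma_M^i|))$ of disjoint subsets of $\{1,\dots,p\}$, of which only the last may be empty; every woman $w_j$ has such a list $\sigma_W^j$ of subsets of $\{1,\dots,n\}$. Candidates in no set are unacceptable; candidates in the same set are tied; earlier sets are preferred; the last set is tied with staying single; staying single is strictly preferred to an unacceptable partner. For a person $x$, $y\le^x z$ (resp. $y<^x z$) means that $x$ prefers $y$ at least as much as (resp. strictly to) $z$, for $y,z$ among the acceptable partners of $x$ and $x$ itself. A set of marriages is a set $S$ of pairs $(m,w)$ and $(x,x)$ ("$x$ is single") in which every person occurs in exactly one pair. It is (weakly) stable if no man and woman strictly prefer each other to their partners and nobody strictly prefers being single to his or her partner. **Costs.** Fix one of two conventions for the cost $c_x(y)$ of the partner $y$ (an acceptable partner, or $y=x$ if $x$ is single) for the person $x$: (a) $c_x(y)$ is the index of the set containing $y$ in the list of $x$, and $c_x(x)$ is the length of this list; or (b) $c_x(y)=|\{z: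 z<^x y\}|+1$. The same convention is used in the criteria and in the program. With $c_x(S)=c_x(\text{partner of }x\text{ in }S)$, put $c_{sexeq}(S)=|\sum_{x\text{ man}}c_x(S)-\sum_{x\text{ woman}}c_x(S)|$, $c_{weight}(S)=\sum_x c_x(S)$, $c_{regret}(S)=\max_x c_x(S)$, $c_{singles}(S)=|\{z:(z,z)\in S\}|$. For $crit\in\{sexeq,weight,regret,singles\}$, $S$ is optimal if it is stable and has minimal $c_{crit}$ among the stable sets. **Answer sets.** An interpretation $I$ is a set of ground atoms. The reduct of a ground disjunctive program w.r.t. $I$ deletes the rules with a literal $not\ c$, $c\in I$, or with an aggregate that is false in $I$, and deletes the literals $not\ c$ from the other rules. $I$ is an answer set if it is a model of its reduct and no strict subset of $I$ is one. Numeric variables range over $\mathbb N$. **The program $\mathcal P_{crit}$** is the union of the following three groups of rules; $i$ ranges over $1..n$, $j$ over $1..p$. *Group 1 (candidate and its value).* - $accept(m_i,w_j)\leftarrow manpropose(m_i,w_j),womanpropose(m_i,w_j)$; - $accept(m_i,m_i)\leftarrow\{not\ accept(m_i,w_k): w_k\text{ acceptable for }m_i\}$; - $accept(w_j,w_j)\leftarrow\{not\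 accept(m_k,w_j): m_k\text{ acceptable for }w_j\}$; - $manpropose(m_i,w_j)\leftarrow\{not\ accept(m_i,x): x\le^{m_i}w_j,\ x\ne w_j\}$ for $w_j$ acceptable for $m_i$; - $womanpropose(m_i,w_j)\leftarrow\{not\ accept(x,w_j): x\le^{w_j}m_i,\ x\ne m_i\}$ for $m_i$ acceptable for $w_j$. If $crit\neq singles$, the cost rules - $mancost(i,c_{m_i}(w_j))\leftarrow accept(m_i,w_j)$ for $w_j$ acceptable for $m_i$; $mancost(i,c_{m_i}(m_i))\leftarrow accept(m_i,m_i)$; - $womancost(j,c_{w_j}(m_i))\leftarrow accept(m_i,w_j)$ for $m_i$ acceptable for $w_j$; $womancost(j,c_{w_j}(w_j))\leftarrow accept(w_j,w_j)$. If $crit\in\{sexeq,weight\}$: $manweight(Z)\leftarrow \#sum\{B,A:mancost(A,B)\}=Z$ and $womanweight(Z)\leftarrow\#sum\{B,A:womancost(A,B)\}=Z$, with, for $X,Y,Z\in\mathbb N$ and body $manweight(X),womanweight(Y)$, the heads $sexeq(Z)$ if $Z=X-Y$ or $Z=Y-X$ (for $sexeq$), resp. $weight(Z)$ if $Z=X+Y$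 (for $weight$). If $crit=regret$: $manregret(Z)\leftarrow\#max\{B:mancost(A,B)\}=Z$, likewise $womanregret$, and with body $manregret(X),womanregret(Y)$ the head $regret(X)$ if $X>Y$, $regret(Y)$ if $X\le Y$. If $crit=singles$: $singles(Z)\leftarrow\#count\{B:accept(B,B)\}=Z$. *Group 2 (a second candidate, without $not$; primed predicates, the prefix $n$ playing the role of negation).* - $naccept'(m_i,w_j)\vee manpropose'(m_i,w_j)\leftarrow$; $\ naccept'(m_i,w_j)\vee womanpropose'(m_i,w_j)\leftarrow$; - $accept'(m_i,w_j)\vee nmanpropose'(m_i,w_j)\vee nwomanpropose'(m_i,w_j)\leftarrow$; - for every $i$: $\bigvee_{w_k\text{ acceptable for }m_i}accept'(m_i,w_k)\vee accept'(m_i,m_i)\leftarrow$; - for $w_j$ acceptable for $m_i$: $naccept'(m_i,m_i)\vee naccept'(m_i,w_j)\leftarrow$; $\ nmanpropose'(m_i,w_j)\vee naccept'(m_i,x)\leftarrow$ for every $x\le^{m_i}w_j$, $x\neq w_j$; $\ \bigvee_{x\le^{m_i}w_j,x\ne w_j}accept'(m_i,x)\vee manpropose'(m_i,w_j)\leftarrow$;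 - $nmanpropose'(m_i,w_l)\leftarrow$ for $w_l$ unacceptable for $m_i$; - the symmetric versions of the last three items for the women, with $womanpropose'$; - $sat\leftarrow a,na$ for every atom $a$ of the form $accept'(m_i,w_j)$, $accept'(m_i,m_i)$, $accept'(w_j,w_j)$, $manpropose'(m_i,w_j)$, $womanpropose'(m_i,w_j)$. If $crit\ne singles$, the cost rules with primed predicates. If $crit\in\{sexeq,weight\}$: $mansum'(n,X)\leftarrow mancost'(n,X)$; $mansum'(J,X+Y)\leftarrow mansum'(J+1,X),mancost'(J,Y)$; $manweight'(Z)\leftarrow mansum'(1,Z)$; likewise for the women with $p$ in place of $n$. If $crit=regret$: $manmax'(n,X)\leftarrow mancost'(n,X)$; with body $manmax'(J+1,X),mancost'(J,Y)$ the head $manmax'(J,X)$ if $X\ge Y$ and $manmax'(J,Y)$ if $X<Y$; $manregret'(Z)\leftarrow manmax'(1,Z)$; likewise for the women with $p$. In these cases also the rules of group 1 that compute $crit$ from the value for the men and the value for the women, with primed predicates. If $crit=singles$: $single'(p+i,1)\leftarrow accept'(m_i,m_i)$; $single'(p+i,0)\leftarrow naccept'(m_i,m_i)$; $single'(j,1)\leftarrow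 accept'(w_j,w_j)$; $single'(j,0)\leftarrow naccept'(w_j,w_j)$; $singlesum'(n+p,X)\leftarrow single'(n+p,X)$; $singlesum'(J,X+Y)\leftarrow singlesum'(J+1,X),single'(J,Y)$; $singles'(Z)\leftarrow singlesum'(1,Z)$. *Group 3 (saturation).* $sat\leftarrow crit(X),crit'(Y)$ for $X\le Y$; the constraint $\leftarrow not\ sat$; $mancost'(X,Y)\leftarrow sat,manargcost_1'(X),manargcost_2'(Y)$; $womancost'(X,Y)\leftarrow sat,womanargcost_1'(X),womanargcost_2'(Y)$; for each $h\in\{manpropose',womanpropose',accept',nmanpropose',nwomanpropose',naccept'\}$ the rule $h(X,Y)\leftarrow sat,man(X),woman(Y)$; for each $h\in\{accept',naccept'\}$ the rules $h(X,X)\leftarrow sat,man(X)$ and $h(X,X)\leftarrow sat,woman(X)$; the facts $manargcost_1'(1..n)$, $manargcost_2'(1..(p+1))$, $womanargcost_1'(1..p)$, $womanargcost_2'(1..(n+1))$, $man(m_i)$, $woman(w_j)$. **Proposition.** Let $crit\in\{sexeq,weight,regret,singles\}$. For every answer set $I$ of $\mathcal P_{crit}$, the set $S_I=\{(x,y): accept(x,y)\in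 I\}$ is an optimal stable set of marriages w.r.t. $crit$, and there is exactly one $v$ with $crit(v)\in I$, namely the optimal value $v=c_{crit}(S_I)$. Conversely, for every optimal stable set $S$ with optimal value $v=c_{crit}(S)$ there is an answer set $I$ of $\mathcal P_{crit}$ with $\{(x,y):accept(x,y)\in I\}=S$, and $v$ is the unique value with $crit(v)\in I$. -/

import Mathlib

/-! ## Disjunctive answer set programs -/

namespace StableASP

/-- A ground disjunctive rule
`a₁ ∨ … ∨ aₖ ← b₁, …, bₘ, not c₁, …, not cₙ, (aggregates)`.
The field `agg` is the conjunction of the aggregate literals of the body, as a condition on the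
interpretation in which they are evaluated (it is `True` for a rule without aggregates).
Comparisons and arithmetic built-ins are evaluated when a program is grounded. -/
structure Rule (α : Type) where
  head : Set α
  pos : Set α
  neg : Set α := ∅
  agg : Set α → Prop := fun _ => True

/-- A (ground) disjunctive program. -/
abbrev Program (α : Type) := Set (Rule α)

variable {α : Type}

/-- Satisfaction of a rule without negation-as-failure. -/
def Rule.SatisfiedBy (r : Rule α) (I : Set α) : Prop :=
  r.pos ⊆ I → r.agg I → ∃ a ∈ r.head, a ∈ I

/-- The reduct: a rule is deleted if one of its negation-as-failure literals or aggregate literals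
is false in `I`; the negation-as-failure literals of the other rules are removed. For rules without
aggregates this is the Gelfond-Lifschitz reduct. -/
def reduct (Q : Program α) (I : Set α) : Program α :=
  {r | ∃ r₀ ∈ Q, r₀.neg ∩ I = ∅ ∧ r₀.agg I ∧ r = ⟨r₀.head, r₀.pos, ∅, r₀.agg⟩}

/-- `I` is a model of a program without negation-as-failure. -/
def IsModel (Q : Program α) (I : Set α) : Prop := ∀ r ∈ Q, r.SatisfiedBy I

/-- `I` is an answer set of `Q`: a minimal model of the reduct of `Q` with respect to `I`. -/
def IsAnswerSet (Q : Program α) (I : Set α) : Prop :=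
  IsModel (reduct Q I) I ∧ ∀ J, J ⊂ I → ¬ IsModel (reduct Q I) J

end StableASP

/-! ## Stable marriage with unacceptability and ties -/

namespace StableASP

/-- A preference list over `q` candidates: a nonempty list of disjoint sets of candidates, of which
only the last one (the candidates tied with staying single) may be empty. -/
structure PrefList (q : ℕ) where
  groups : List (Finset (Fin q))
  ne_nil : groups ≠ []
  disjoint : groups.Pairwise Disjoint
  nonempty : ∀ s ∈ groups.dropLast, s.Nonempty

/-- The length of a preference list. -/
def PrefList.length {q : ℕ} (σ : PrefList q) : ℕ := σ.groups.length

/-- The 1-based index of the group that contains candidate `j`; it is `σ.length + 1` if `j` is in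
no group, i.e. if `j` is unacceptable. -/
def PrefList.index {q : ℕ} (σ : PrefList q) (j : Fin q) : ℕ :=
  σ.groups.findIdx (fun s => decide (j ∈ s)) + 1

/-- An instance with men `m_1, …, m_n` and women `w_1, …, w_p`. -/
structure Instance (n p : ℕ) where
  men : Fin n → PrefList p
  women : Fin p → PrefList n

/-- The persons: `Sum.inl i` is a man, `Sum.inr j` is a woman. -/
abbrev Person (n p : ℕ) := Fin n ⊕ Fin p

/-- The man `m_{i+1}`. -/
abbrev m {n p : ℕ} (i : Fin n) : Person n p := Sum.inl i

/-- The woman `w_{j+1}`. -/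
abbrev w {n p : ℕ} (j : Fin p) : Person n p := Sum.inr j

namespace Instance

variable {n p : ℕ} (P : Instance n p)

/-- The length of the preference list of a person. -/
def len : Person n p → ℕ
  | Sum.inl i => (P.men i).length
  | Sum.inr j => (P.women j).length

/-- The position of `y` in the preferences of `x`: the index of the group of `y` if `y` is an
acceptable partner, the index of the last group if `y = x` (staying single), and the length of the
list plus one otherwise. -/
def pos : Person n p → Person n p → ℕ
  | Sum.inl i, Sum.inr j => (P.men i).index j
  | Sum.inr j, Sum.inl i => (P.women j).index i
  | Sum.inl i, Sum.inl i' =>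
      if i' = i then (P.men i).length else (P.men i).length + 1
  | Sum.inr j, Sum.inr j' =>
      if j' = j then (P.women j).length else (P.women j).length + 1

/-- The persons ordered by the preferences of `x`: the acceptable partners of `x`, and `x`. -/
def Acc (x y : Person n p) : Prop := P.pos x y ≤ P.len x

/-- `P.Le x y z`: the persons `y` and `z` are ordered by the preferences of `x`, and `x` prefers `y`
at least as much as `z`. -/
def Le (x y z : Person n p) : Prop := P.Acc x y ∧ P.Acc x z ∧ P.pos x y ≤ P.pos x z

/-- `x` strictly prefers `y` to `z`; in particular `x` strictly prefers staying single, and every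
acceptable partner, to an unacceptable partner. -/
def Lt (x y z : Person n p) : Prop := P.pos x y < P.pos x z

end Instance

variable {n p : ℕ}

/-- A set of marriages: a set of singles `(x, x)` and man-woman pairs `(m, w)` such that every
person occurs in exactly one pair. -/
def IsMarriages (S : Set (Person n p × Person n p)) : Prop :=
  (∀ q ∈ S, q.1 = q.2 ∨ ∃ i j, q = (m i, w j)) ∧
  ∀ x : Person n p, ∃! q, q ∈ S ∧ (x = q.1 ∨ x = q.2)

open Classical in
/-- The partner of `x` in a set of marriages (`x` itself if `x` is single). -/
noncomputable def partner (S : Set (Person n p × Person n p)) (x : Person n p) : Person n p :=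
  if h : ∃ y, (x, y) ∈ S ∨ (y, x) ∈ S then h.choose else x

/-- A weakly stable set of marriages: there are no blocking pairs and no blocking individuals. -/
def IsStable (P : Instance n p) (S : Set (Person n p × Person n p)) : Prop :=
  IsMarriages S ∧
  (∀ i j, ¬ (P.Lt (m i) (w j) (partner S (m i)) ∧ P.Lt (w j) (m i) (partner S (w j)))) ∧
  ∀ x, ¬ P.Lt x x (partner S x)

/-- Two ways of measuring the position of a partner in a list with ties: by the index of the group
of the partner, or by one plus the number of strictly preferred persons. They agree for lists
whose groups, the last one excepted, are singletons. -/
inductive CostConvention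
  | groupIndex
  | strictlyBetter

/-- The cost for `x` of having `y` as a partner (of being single, if `y = x`). -/
noncomputable def cost (P : Instance n p) (κ : CostConvention) (x y : Person n p) : ℕ :=
  match κ with
  | .groupIndex => P.pos x y
  | .strictlyBetter => {z | P.Lt x z y}.ncard + 1

/-- The four criteria: sex-equalness, egalitarian, minimum regret, maximum cardinality. -/
inductive Criterion
  | sexeq
  | weight
  | regret
  | singles

/-- The criterion value of a set of marriages. -/
noncomputable def critCost (P : Instance n p) (κ : CostConvention) (c : Criterion)
    (S : Set (Person n p × Person n p)) : ℕ :=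
  match c with
  | .sexeq => ((∑ i : Fin n, (cost P κ (m i) (partner S (m i)) : ℤ)) -
      ∑ j : Fin p, (cost P κ (w j) (partner S (w j)) : ℤ)).natAbs
  | .weight => ∑ x : Person n p, cost P κ x (partner S x)
  | .regret => Finset.univ.sup fun x : Person n p => cost P κ x (partner S x)
  | .singles => {z | (z, z) ∈ S}.ncard

/-- A stable set of marriages whose criterion value is minimal among all stable sets. -/
def IsOptimal (P : Instance n p) (κ : CostConvention) (c : Criterion)
    (S : Set (Person n p × Person n p)) : Prop :=
  IsStable P S ∧ ∀ T, IsStable P T → critCost P κ c S ≤ critCost P κ c T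

end StableASP

/-! ## The programs -/

namespace StableASP

/-- The ground atoms. Primed names belong to the second, negation-free copy of the program; a
prefix `n` stands for the atoms that replace strongly negated atoms there. The predicates `sexeq`,
`weight`, `regret`, `singles` are `crit c`, and their primed versions are `crit' c`. -/
inductive Atom (n p : ℕ) : Type
  | accept (x y : Person n p)
  | manpropose (x y : Person n p)
  | womanpropose (x y : Person n p)
  | mancost (i k : ℕ)
  | womancost (j k : ℕ)
  | manweight (z : ℕ)
  | womanweight (z : ℕ)
  | manregret (z : ℕ)
  | womanregret (z : ℕ)
  | crit (c : Criterion) (v : ℕ)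
  | accept' (x y : Person n p)
  | manpropose' (x y : Person n p)
  | womanpropose' (x y : Person n p)
  | naccept' (x y : Person n p)
  | nmanpropose' (x y : Person n p)
  | nwomanpropose' (x y : Person n p)
  | mancost' (i k : ℕ)
  | womancost' (j k : ℕ)
  | mansum' (i z : ℕ)
  | womansum' (j z : ℕ)
  | manweight' (z : ℕ)
  | womanweight' (z : ℕ)
  | manmax' (i z : ℕ)
  | womanmax' (j z : ℕ)
  | manregret' (z : ℕ)
  | womanregret' (z : ℕ)
  | single' (i z : ℕ)
  | singlesum' (i z : ℕ)
  | crit' (c : Criterion) (v : ℕ)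
  | sat
  | man (x : Person n p)
  | woman (x : Person n p)
  | manargcost₁' (k : ℕ)
  | manargcost₂' (k : ℕ)
  | womanargcost₁' (k : ℕ)
  | womanargcost₂' (k : ℕ)

open Atom

variable {n p : ℕ}

/-- The rules of the normal program induced by an instance. -/
inductive NormRule (P : Instance n p) : Rule (Atom n p) → Prop
  | accept (i : Fin n) (j : Fin p) : NormRule P
      { head := {accept (m i) (w j)}
        pos := {manpropose (m i) (w j), womanpropose (m i) (w j)} }
  | manSingle (i : Fin n) : NormRule P
      { head := {accept (m i) (m i)}
        pos := ∅
        neg := {a | ∃ k : Fin p, P.Acc (m i) (w k) ∧ a = accept (m i) (w k)} }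
  | womanSingle (j : Fin p) : NormRule P
      { head := {accept (w j) (w j)}
        pos := ∅
        neg := {a | ∃ k : Fin n, P.Acc (w j) (m k) ∧ a = accept (m k) (w j)} }
  | manpropose (i : Fin n) (j : Fin p) (h : P.Acc (m i) (w j)) : NormRule P
      { head := {manpropose (m i) (w j)}
        pos := ∅
        neg := {a | ∃ x, P.Le (m i) x (w j) ∧ x ≠ w j ∧ a = accept (m i) x} }
  | womanpropose (i : Fin n) (j : Fin p) (h : P.Acc (w j) (m i)) : NormRule P
      { head := {womanpropose (m i) (w j)}
        pos := ∅
        neg := {a | ∃ x, P.Le (w j) x (m i) ∧ x ≠ m i ∧ a = accept x (w j)} }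

/-- The rules that determine the individual costs. -/
inductive CostRule (P : Instance n p) (κ : CostConvention) : Rule (Atom n p) → Prop
  | mancost (i : Fin n) (j : Fin p) (h : P.Acc (m i) (w j)) : CostRule P κ
      { head := {mancost (i + 1) (cost P κ (m i) (w j))}
        pos := {accept (m i) (w j)} }
  | womancost (i : Fin n) (j : Fin p) (h : P.Acc (w j) (m i)) : CostRule P κ
      { head := {womancost (j + 1) (cost P κ (w j) (m i))}
        pos := {accept (m i) (w j)} }
  | mancostSingle (i : Fin n) : CostRule P κ
      { head := {mancost (i + 1) (cost P κ (m i) (m i))}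
        pos := {accept (m i) (m i)} }
  | womancostSingle (j : Fin p) : CostRule P κ
      { head := {womancost (j + 1) (cost P κ (w j) (w j))}
        pos := {accept (w j) (w j)} }

/-- The aggregate literal `#sum{B, A : f(A, B)} = Z`. -/
def SumAgg (f : ℕ → ℕ → Atom n p) (Z : ℕ) (I : Set (Atom n p)) : Prop :=
  {t : ℕ × ℕ | f t.2 t.1 ∈ I}.Finite ∧ ∑ᶠ t ∈ {t : ℕ × ℕ | f t.2 t.1 ∈ I}, t.1 = Z

/-- The aggregate literal `#max{B : f(A, B)} = Z`. -/
def MaxAgg (f : ℕ → ℕ → Atom n p) (Z : ℕ) (I : Set (Atom n p)) : Prop :=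
  IsGreatest {B | ∃ A, f A B ∈ I} Z

/-- The aggregate literal `#count{B : accept(B, B)} = Z`. -/
def CountAgg (Z : ℕ) (I : Set (Atom n p)) : Prop :=
  {B : Person n p | accept B B ∈ I}.ncard = Z

/-- The rules that determine the sums of the costs of the men and of the women. -/
inductive WeightRule : Rule (Atom n p) → Prop
  | manweight (z : ℕ) : WeightRule
      { head := {manweight z}, pos := ∅, agg := SumAgg mancost z }
  | womanweight (z : ℕ) : WeightRule
      { head := {womanweight z}, pos := ∅, agg := SumAgg womancost z }

/-- The rules that determine the maximal costs of the men and of the women. -/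
inductive RegretRule : Rule (Atom n p) → Prop
  | manregret (z : ℕ) : RegretRule
      { head := {manregret z}, pos := ∅, agg := MaxAgg mancost z }
  | womanregret (z : ℕ) : RegretRule
      { head := {womanregret z}, pos := ∅, agg := MaxAgg womancost z }

/-- The rules that compute the criterion value from a value `man(X)` for the men and a value
`woman(Y)` for the women. The differences are taken in the nonnegative integers. -/
inductive CombineRule (man woman crit : ℕ → Atom n p) : Criterion → Rule (Atom n p) → Prop
  | sexeq₁ (x y z : ℕ) (h : z + y = x) : CombineRule man woman crit .sexeq
      { head := {crit z}, pos := {man x, woman y} }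
  | sexeq₂ (x y z : ℕ) (h : z + x = y) : CombineRule man woman crit .sexeq
      { head := {crit z}, pos := {man x, woman y} }
  | weight (x y z : ℕ) (h : z = x + y) : CombineRule man woman crit .weight
      { head := {crit z}, pos := {man x, woman y} }
  | regret₁ (x y : ℕ) (h : x > y) : CombineRule man woman crit .regret
      { head := {crit x}, pos := {man x, woman y} }
  | regret₂ (x y : ℕ) (h : x ≤ y) : CombineRule man woman crit .regret
      { head := {crit y}, pos := {man x, woman y} }

/-- The rules that determine the number of singles. -/
inductive SinglesRule : Rule (Atom n p) → Prop
  | singles (z : ℕ) : SinglesRule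
      { head := {crit .singles z}, pos := ∅, agg := CountAgg z }

/-- The normal program extended with the computation of the criterion value. -/
def extProgram (P : Instance n p) (κ : CostConvention) (c : Criterion) : Program (Atom n p) :=
  {r | NormRule P r} ∪
  match c with
  | .sexeq => {r | CostRule P κ r} ∪ {r | WeightRule r} ∪
      {r | CombineRule manweight womanweight (crit .sexeq) .sexeq r}
  | .weight => {r | CostRule P κ r} ∪ {r | WeightRule r} ∪
      {r | CombineRule manweight womanweight (crit .weight) .weight r}
  | .regret => {r | CostRule P κ r} ∪ {r | RegretRule r} ∪
      {r | CombineRule manregret womanregret (crit .regret) .regret r}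
  | .singles => {r | SinglesRule r}

/-- The rules of the disjunctive program without negation-as-failure, with primed predicates and
with the prefix `n` in the place of strong negation. -/
inductive DisjRule' (P : Instance n p) : Rule (Atom n p) → Prop
  | accept₁ (i : Fin n) (j : Fin p) : DisjRule' P
      { head := {naccept' (m i) (w j), manpropose' (m i) (w j)}, pos := ∅ }
  | accept₂ (i : Fin n) (j : Fin p) : DisjRule' P
      { head := {naccept' (m i) (w j), womanpropose' (m i) (w j)}, pos := ∅ }
  | accept₃ (i : Fin n) (j : Fin p) : DisjRule' P
      { head := {accept' (m i) (w j), nmanpropose' (m i) (w j), nwomanpropose' (m i) (w j)}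
        pos := ∅ }
  | manSingle₁ (i : Fin n) : DisjRule' P
      { head := {a | ∃ k : Fin p, P.Acc (m i) (w k) ∧ a = accept' (m i) (w k)} ∪
          {accept' (m i) (m i)}
        pos := ∅ }
  | manSingle₂ (i : Fin n) (j : Fin p) (h : P.Acc (m i) (w j)) : DisjRule' P
      { head := {naccept' (m i) (m i), naccept' (m i) (w j)}, pos := ∅ }
  | manpropose₁ (i : Fin n) (j : Fin p) (h : P.Acc (m i) (w j)) (x : Person n p)
      (hx : P.Le (m i) x (w j)) (hne : x ≠ w j) : DisjRule' P
      { head := {nmanpropose' (m i) (w j), naccept' (m i) x}, pos := ∅ }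
  | manpropose₂ (i : Fin n) (j : Fin p) (h : P.Acc (m i) (w j)) : DisjRule' P
      { head := {a | ∃ x, P.Le (m i) x (w j) ∧ x ≠ w j ∧ a = accept' (m i) x} ∪
          {manpropose' (m i) (w j)}
        pos := ∅ }
  | manpropose₃ (i : Fin n) (l : Fin p) (h : ¬ P.Acc (m i) (w l)) : DisjRule' P
      { head := {nmanpropose' (m i) (w l)}, pos := ∅ }
  | womanSingle₁ (j : Fin p) : DisjRule' P
      { head := {a | ∃ k : Fin n, P.Acc (w j) (m k) ∧ a = accept' (m k) (w j)} ∪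
          {accept' (w j) (w j)}
        pos := ∅ }
  | womanSingle₂ (i : Fin n) (j : Fin p) (h : P.Acc (w j) (m i)) : DisjRule' P
      { head := {naccept' (w j) (w j), naccept' (m i) (w j)}, pos := ∅ }
  | womanpropose₁ (i : Fin n) (j : Fin p) (h : P.Acc (w j) (m i)) (x : Person n p)
      (hx : P.Le (w j) x (m i)) (hne : x ≠ m i) : DisjRule' P
      { head := {nwomanpropose' (m i) (w j), naccept' x (w j)}, pos := ∅ }
  | womanpropose₂ (i : Fin n) (j : Fin p) (h : P.Acc (w j) (m i)) : DisjRule' P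
      { head := {a | ∃ x, P.Le (w j) x (m i) ∧ x ≠ m i ∧ a = accept' x (w j)} ∪
          {womanpropose' (m i) (w j)}
        pos := ∅ }
  | womanpropose₃ (l : Fin n) (j : Fin p) (h : ¬ P.Acc (w j) (m l)) : DisjRule' P
      { head := {nwomanpropose' (m l) (w j)}, pos := ∅ }

/-- The rules `sat ← atom, natom`. -/
inductive ConsistencyRule' : Rule (Atom n p) → Prop
  | accept (i : Fin n) (j : Fin p) : ConsistencyRule'
      { head := {sat}, pos := {accept' (m i) (w j), naccept' (m i) (w j)} }
  | manSingle (i : Fin n) : ConsistencyRule'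
      { head := {sat}, pos := {accept' (m i) (m i), naccept' (m i) (m i)} }
  | womanSingle (j : Fin p) : ConsistencyRule'
      { head := {sat}, pos := {accept' (w j) (w j), naccept' (w j) (w j)} }
  | manpropose (i : Fin n) (j : Fin p) : ConsistencyRule'
      { head := {sat}, pos := {manpropose' (m i) (w j), nmanpropose' (m i) (w j)} }
  | womanpropose (i : Fin n) (j : Fin p) : ConsistencyRule'
      { head := {sat}, pos := {womanpropose' (m i) (w j), nwomanpropose' (m i) (w j)} }

/-- The rules that determine the individual costs, with primed predicates. -/
inductive CostRule' (P : Instance n p) (κ : CostConvention) : Rule (Atom n p) → Prop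
  | mancost (i : Fin n) (j : Fin p) (h : P.Acc (m i) (w j)) : CostRule' P κ
      { head := {mancost' (i + 1) (cost P κ (m i) (w j))}
        pos := {accept' (m i) (w j)} }
  | womancost (i : Fin n) (j : Fin p) (h : P.Acc (w j) (m i)) : CostRule' P κ
      { head := {womancost' (j + 1) (cost P κ (w j) (m i))}
        pos := {accept' (m i) (w j)} }
  | mancostSingle (i : Fin n) : CostRule' P κ
      { head := {mancost' (i + 1) (cost P κ (m i) (m i))}
        pos := {accept' (m i) (m i)} }
  | womancostSingle (j : Fin p) : CostRule' P κ
      { head := {womancost' (j + 1) (cost P κ (w j) (w j))}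
        pos := {accept' (w j) (w j)} }

/-- The successive computation of the sums of the costs. -/
inductive WeightRule' : Rule (Atom n p) → Prop
  | mansum₁ (x : ℕ) : WeightRule'
      { head := {mansum' n x}, pos := {mancost' n x} }
  | mansum₂ (I J x y z : ℕ) (hz : z = x + y) (hs : J + 1 = I) : WeightRule'
      { head := {mansum' J z}, pos := {mansum' I x, mancost' J y} }
  | manweight (z : ℕ) : WeightRule'
      { head := {manweight' z}, pos := {mansum' 1 z} }
  | womansum₁ (x : ℕ) : WeightRule'
      { head := {womansum' p x}, pos := {womancost' p x} }
  | womansum₂ (I J x y z : ℕ) (hz : z = x + y) (hs : J + 1 = I) : WeightRule'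
      { head := {womansum' J z}, pos := {womansum' I x, womancost' J y} }
  | womanweight (z : ℕ) : WeightRule'
      { head := {womanweight' z}, pos := {womansum' 1 z} }

/-- The successive computation of the maximal costs. -/
inductive RegretRule' : Rule (Atom n p) → Prop
  | manmax₁ (x : ℕ) : RegretRule'
      { head := {manmax' n x}, pos := {mancost' n x} }
  | manmax₂ (I J x y : ℕ) (h : x ≥ y) (hs : J + 1 = I) : RegretRule'
      { head := {manmax' J x}, pos := {manmax' I x, mancost' J y} }
  | manmax₃ (I J x y : ℕ) (h : x < y) (hs : J + 1 = I) : RegretRule'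
      { head := {manmax' J y}, pos := {manmax' I x, mancost' J y} }
  | manregret (z : ℕ) : RegretRule'
      { head := {manregret' z}, pos := {manmax' 1 z} }
  | womanmax₁ (x : ℕ) : RegretRule'
      { head := {womanmax' p x}, pos := {womancost' p x} }
  | womanmax₂ (I J x y : ℕ) (h : x ≥ y) (hs : J + 1 = I) : RegretRule'
      { head := {womanmax' J x}, pos := {womanmax' I x, womancost' J y} }
  | womanmax₃ (I J x y : ℕ) (h : x < y) (hs : J + 1 = I) : RegretRule'
      { head := {womanmax' J y}, pos := {womanmax' I x, womancost' J y} }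
  | womanregret (z : ℕ) : RegretRule'
      { head := {womanregret' z}, pos := {womanmax' 1 z} }

/-- The successive computation of the number of singles. -/
inductive SinglesRule' : Rule (Atom n p) → Prop
  | man₁ (i : Fin n) : SinglesRule'
      { head := {single' (p + (i + 1)) 1}, pos := {accept' (m i) (m i)} }
  | man₀ (i : Fin n) : SinglesRule'
      { head := {single' (p + (i + 1)) 0}, pos := {naccept' (m i) (m i)} }
  | woman₁ (j : Fin p) : SinglesRule'
      { head := {single' (j + 1) 1}, pos := {accept' (w j) (w j)} }
  | woman₀ (j : Fin p) : SinglesRule'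
      { head := {single' (j + 1) 0}, pos := {naccept' (w j) (w j)} }
  | singlesum₁ (x : ℕ) : SinglesRule'
      { head := {singlesum' (n + p) x}, pos := {single' (n + p) x} }
  | singlesum₂ (I J x y z : ℕ) (hz : z = x + y) (hs : J + 1 = I) : SinglesRule'
      { head := {singlesum' J z}, pos := {singlesum' I x, single' J y} }
  | singles (z : ℕ) : SinglesRule'
      { head := {crit' .singles z}, pos := {singlesum' 1 z} }

/-- The primed program: candidates for comparison, and their criterion values. -/
def extProgram' (P : Instance n p) (κ : CostConvention) (c : Criterion) : Program (Atom n p) :=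
  {r | DisjRule' P r} ∪ {r | ConsistencyRule' r} ∪
  match c with
  | .sexeq => {r | CostRule' P κ r} ∪ {r | WeightRule' r} ∪
      {r | CombineRule manweight' womanweight' (crit' .sexeq) .sexeq r}
  | .weight => {r | CostRule' P κ r} ∪ {r | WeightRule' r} ∪
      {r | CombineRule manweight' womanweight' (crit' .weight) .weight r}
  | .regret => {r | CostRule' P κ r} ∪ {r | RegretRule' r} ∪
      {r | CombineRule manregret' womanregret' (crit' .regret) .regret r}
  | .singles => {r | SinglesRule' r}

/-- The rules that compare the two candidates, and the saturation rules. -/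
inductive SatRule (c : Criterion) : Rule (Atom n p) → Prop
  | compare (x y : ℕ) (h : x ≤ y) : SatRule c
      { head := {sat}, pos := {crit c x, crit' c y} }
  | notSat : SatRule c { head := ∅, pos := ∅, neg := {sat} }
  | mancost (x y : ℕ) : SatRule c
      { head := {mancost' x y}, pos := {sat, manargcost₁' x, manargcost₂' y} }
  | womancost (x y : ℕ) : SatRule c
      { head := {womancost' x y}, pos := {sat, womanargcost₁' x, womanargcost₂' y} }
  | manpropose (x y : Person n p) : SatRule c
      { head := {manpropose' x y}, pos := {sat, man x, woman y} }
  | womanpropose (x y : Person n p) : SatRule c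
      { head := {womanpropose' x y}, pos := {sat, man x, woman y} }
  | acceptMan (x : Person n p) : SatRule c
      { head := {accept' x x}, pos := {sat, man x} }
  | acceptWoman (x : Person n p) : SatRule c
      { head := {accept' x x}, pos := {sat, woman x} }
  | accept (x y : Person n p) : SatRule c
      { head := {accept' x y}, pos := {sat, man x, woman y} }
  | nmanpropose (x y : Person n p) : SatRule c
      { head := {nmanpropose' x y}, pos := {sat, man x, woman y} }
  | nwomanpropose (x y : Person n p) : SatRule c
      { head := {nwomanpropose' x y}, pos := {sat, man x, woman y} }
  | nacceptMan (x : Person n p) : SatRule c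
      { head := {naccept' x x}, pos := {sat, man x} }
  | nacceptWoman (x : Person n p) : SatRule c
      { head := {naccept' x x}, pos := {sat, woman x} }
  | naccept (x y : Person n p) : SatRule c
      { head := {naccept' x y}, pos := {sat, man x, woman y} }
  | manarg₁ (k : ℕ) (h₁ : 1 ≤ k) (h₂ : k ≤ n) : SatRule c
      { head := {manargcost₁' k}, pos := ∅ }
  | manarg₂ (k : ℕ) (h₁ : 1 ≤ k) (h₂ : k ≤ p + 1) : SatRule c
      { head := {manargcost₂' k}, pos := ∅ }
  | womanarg₁ (k : ℕ) (h₁ : 1 ≤ k) (h₂ : k ≤ p) : SatRule c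
      { head := {womanargcost₁' k}, pos := ∅ }
  | womanarg₂ (k : ℕ) (h₁ : 1 ≤ k) (h₂ : k ≤ n + 1) : SatRule c
      { head := {womanargcost₂' k}, pos := ∅ }
  | man (i : Fin n) : SatRule c { head := {man (m i)}, pos := ∅ }
  | woman (j : Fin p) : SatRule c { head := {woman (w j)}, pos := ∅ }

/-- The saturation-based disjunctive program for a criterion. -/
def critProgram (P : Instance n p) (κ : CostConvention) (c : Criterion) : Program (Atom n p) :=
  extProgram P κ c ∪ extProgram' P κ c ∪ {r | SatRule c r}

/-- The set of pairs described by the `accept` atoms of an interpretation. -/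
def acceptedPairs (I : Set (Atom n p)) : Set (Person n p × Person n p) :=
  {q | accept q.1 q.2 ∈ I}

end StableASP

open StableASP

namespace StableASP
variable {n p : ℕ}

/-! ## Stable sets of marriages as fixed points -/

/-! Group 1 guesses a stable set and evaluates it; groups 2 and 3 use minimality of answer sets to
quantify over all competing stable sets.

First candidate. Only group 1 has unprimed heads, so by supportedness the unprimed part of an answer
set satisfies the Clark completion of group 1 (`IsAnswerSet.isCompletion`). Positive and aggregate
dependencies of group 1 are acyclic (`level_lt`), so conversely a solution of the completion cannot
lose unprimed atoms in a smaller model of the reduct (`IsCompletion.mem_of_isModel`). On the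
`accept` atoms the completion is `IsCandidate`, and its solutions are exactly the stable sets
(`IsStable.isCandidate`, `IsCandidate.isStable`): two people who propose to each other without being
matched are a blocking pair. The remaining unprimed atoms are then functions of the stable set.

Second candidate. The disjunctive rules are the clauses of the same completion, with `n`-atoms for
negated atoms. A model of group 2 without `sat` is consistent, hence encodes a stable set and
contains its value (`isCandidate_acceptedPairs'`, `crit'_mem`). Conversely every stable set yields a
`sat`-free choice of primed atoms closed under group 2 (the `comparison` lemmas).

Saturation. From `sat` every head atom of a disjunctive rule is derivable by definite rules
(`DisjRule'.saturated_head`), so in the presence of `sat` the primed part is just the definite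
closure of `sat`. The constraint forces `sat` into every answer set `I`. If a stable `T` were
strictly better than the set read off `I`, intersecting `I` with the atoms true for `T` would remove
`sat` and leave a model of the reduct, since the comparison rule does not apply: this contradicts
minimality. If instead `A` is optimal, its unprimed atoms together with the closure of `sat` form an
answer set: a smaller model keeps the unprimed atoms, and if it lacked `sat` it would encode some
stable `T`, whose value is at least that of `A`, so the comparison rule would produce `sat` after
all. -/

/-- `x` proposes to `y`: `y` is acceptable for `x`, and `x` does not accept anyone else whom `x`
likes at least as much. -/
def ManProposes (P : Instance n p) (A : Set (Person n p × Person n p)) (x y : Person n p) : Prop :=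
  P.Acc x y ∧ ∀ z, P.Le x z y → z ≠ y → (x, z) ∉ A

/-- `y` proposes to `x`: `x` is acceptable for `y`, and no one else whom `y` likes at least as much
is accepted by `y`. -/
def WomanProposes (P : Instance n p) (A : Set (Person n p × Person n p))
    (x y : Person n p) : Prop :=
  P.Acc y x ∧ ∀ z, P.Le y z x → z ≠ x → (z, y) ∉ A

/-- The sets of pairs that solve the completion of the normal program. -/
structure IsCandidate (P : Instance n p) (A : Set (Person n p × Person n p)) : Prop where
  shape : ∀ q ∈ A, q.1 = q.2 ∨ ∃ i j, q = (m i, w j)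
  couple : ∀ i j, (m i, w j) ∈ A ↔
    ManProposes P A (m i) (w j) ∧ WomanProposes P A (m i) (w j)
  manSingle : ∀ i, (m i, m i) ∈ A ↔ ∀ k, P.Acc (m i) (w k) → (m i, w k) ∉ A
  womanSingle : ∀ j, (w j, w j) ∈ A ↔ ∀ k, P.Acc (w j) (m k) → (m k, w j) ∉ A

theorem Instance.acc_self (P : Instance n p) (x : Person n p) : P.Acc x x := by
  cases x <;> simp [Instance.Acc, Instance.pos, Instance.len]

theorem Instance.pos_self (P : Instance n p) (x : Person n p) : P.pos x x = P.len x := by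
  cases x <;> simp [Instance.pos, Instance.len]

theorem Instance.Acc.of_man {P : Instance n p} {i : Fin n} {x : Person n p} (h : P.Acc (m i) x) :
    x = m i ∨ ∃ j, x = w j := by
  rcases x with k | j
  · by_cases hk : k = i
    · simp [hk]
    · simp [Instance.Acc, Instance.pos, Instance.len, hk] at h
  · exact Or.inr ⟨j, rfl⟩

theorem Instance.Acc.of_woman {P : Instance n p} {j : Fin p} {x : Person n p}
    (h : P.Acc (w j) x) : x = w j ∨ ∃ i, x = m i := by
  rcases x with i | k
  · exact Or.inr ⟨i, rfl⟩
  · by_cases hk : k = j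
    · simp [hk]
    · simp [Instance.Acc, Instance.pos, Instance.len, hk] at h

theorem shape_man {A : Set (Person n p × Person n p)}
    (hA : ∀ q ∈ A, q.1 = q.2 ∨ ∃ i j, q = (m i, w j)) {i : Fin n} {y : Person n p}
    (h : (m i, y) ∈ A) : y = m i ∨ ∃ j, y = w j := by
  rcases hA _ h with h | ⟨i', j, h⟩
  · exact Or.inl h.symm
  · exact Or.inr ⟨j, (Prod.ext_iff.mp h).2⟩

theorem shape_man_right {A : Set (Person n p × Person n p)}
    (hA : ∀ q ∈ A, q.1 = q.2 ∨ ∃ i j, q = (m i, w j)) {i : Fin n} {y : Person n p}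
    (h : (y, m i) ∈ A) : y = m i := by
  rcases hA _ h with h | ⟨i', j, h⟩
  · exact h
  · simp [m, w] at h

theorem shape_woman {A : Set (Person n p × Person n p)}
    (hA : ∀ q ∈ A, q.1 = q.2 ∨ ∃ i j, q = (m i, w j)) {j : Fin p} {y : Person n p}
    (h : (y, w j) ∈ A) : y = w j ∨ ∃ i, y = m i := by
  rcases hA _ h with h | ⟨i', j, h⟩
  · exact Or.inl h
  · exact Or.inr ⟨i', (Prod.ext_iff.mp h).1⟩

theorem shape_woman_left {A : Set (Person n p × Person n p)}
    (hA : ∀ q ∈ A, q.1 = q.2 ∨ ∃ i j, q = (m i, w j)) {j : Fin p} {y : Person n p}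
    (h : (w j, y) ∈ A) : y = w j := by
  rcases hA _ h with h | ⟨i', j, h⟩
  · exact h.symm
  · simp [m, w] at h

/-! ### Partners, and the equivalence of stability with the completion -/

theorem partner_eq_iff {A : Set (Person n p × Person n p)} (hA : IsMarriages A)
    (x y : Person n p) : partner A x = y ↔ (x, y) ∈ A ∨ (y, x) ∈ A := by
  obtain ⟨q, ⟨hq, hx⟩, huniq⟩ := hA.2 x
  have hex : ∃ y, (x, y) ∈ A ∨ (y, x) ∈ A := by
    rcases hx with rfl | rfl
    · exact ⟨q.2, Or.inl hq⟩
    · exact ⟨q.1, Or.inr hq⟩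
  have key : ∀ y z, ((x, y) ∈ A ∨ (y, x) ∈ A) → ((x, z) ∈ A ∨ (z, x) ∈ A) → y = z := by
    have aux : ∀ y, ((x, y) ∈ A ∨ (y, x) ∈ A) → (x, y) = q ∨ (y, x) = q := by
      rintro y (h | h)
      · exact Or.inl (huniq _ ⟨h, Or.inl rfl⟩)
      · exact Or.inr (huniq _ ⟨h, Or.inr rfl⟩)
    intro y z hy hz
    have h1 := aux y hy
    have h2 := aux z hz
    -- If the two pairs contain `x` on opposite sides, equating them with `q` makes both other
    -- entries equal to `x`.
    grind
  have hp : (x, partner A x) ∈ A ∨ (partner A x, x) ∈ A := by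
    unfold partner
    rw [dif_pos hex]
    exact hex.choose_spec
  constructor
  · rintro rfl
    exact hp
  · intro h
    exact key _ _ hp h

theorem partner_man_iff {A : Set (Person n p × Person n p)} (hA : IsMarriages A)
    (i : Fin n) (y : Person n p) : partner A (m i) = y ↔ (m i, y) ∈ A := by
  rw [partner_eq_iff hA]
  constructor
  · rintro (h | h)
    · exact h
    · obtain rfl := shape_man_right hA.1 h
      exact h
  · exact Or.inl

theorem partner_woman_iff {A : Set (Person n p × Person n p)} (hA : IsMarriages A)
    (j : Fin p) (y : Person n p) : partner A (w j) = y ↔ (y, w j) ∈ A := by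
  rw [partner_eq_iff hA]
  constructor
  · rintro (h | h)
    · obtain rfl := shape_woman_left hA.1 h
      exact h
    · exact h
  · exact Or.inr

/-- Being single sits in the last group, so "no blocking individual" says exactly that partners are
acceptable. -/
theorem IsStable.acc_partner {P : Instance n p} {A : Set (Person n p × Person n p)}
    (h : IsStable P A) (x : Person n p) : P.Acc x (partner A x) := by
  have := h.2.2 x
  rwa [Instance.Lt, P.pos_self, not_lt] at this

/-- Uniqueness of partners makes matched people propose to each other. Conversely, if two people
propose to each other but are not matched, neither weakly prefers the actual partner to the other,
so they form a blocking pair. -/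
theorem IsStable.isCandidate {P : Instance n p} {A : Set (Person n p × Person n p)}
    (h : IsStable P A) : IsCandidate P A where
  shape := h.1.1
  couple i j := by
    constructor
    · intro hij
      have h1 := (partner_man_iff h.1 i _).mpr hij
      have h2 := (partner_woman_iff h.1 j _).mpr hij
      refine ⟨⟨h1 ▸ h.acc_partner (m i), fun z _ hz hzA => hz ?_⟩,
        ⟨h2 ▸ h.acc_partner (w j), fun z _ hz hzA => hz ?_⟩⟩
      · rw [← (partner_man_iff h.1 i _).mpr hzA, h1]
      · rw [← (partner_woman_iff h.1 j _).mpr hzA, h2]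
    · rintro ⟨⟨ha, hm⟩, ⟨hb, hw⟩⟩
      by_contra hij
      have h1 := (partner_man_iff h.1 i _).mp rfl
      have h2 := (partner_woman_iff h.1 j _).mp rfl
      refine h.2.1 i j ⟨?_, ?_⟩
      · by_contra hlt
        exact hm _ ⟨h.acc_partner _, ha, not_lt.mp hlt⟩ (fun he => hij (he ▸ h1)) h1
      · by_contra hlt
        exact hw _ ⟨h.acc_partner _, hb, not_lt.mp hlt⟩ (fun he => hij (he ▸ h2)) h2
  manSingle i := by
    constructor
    · intro hi k _ hk
      have h1 := (partner_man_iff h.1 i _).mpr hi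
      have h2 := (partner_man_iff h.1 i _).mpr hk
      rw [h1] at h2
      simp [m, w] at h2
    · intro hi
      have h1 := (partner_man_iff h.1 i _).mp rfl
      rcases shape_man h.1.1 h1 with he | ⟨j, he⟩
      · rw [he] at h1; exact h1
      · exact absurd (he ▸ h1) (hi j (he ▸ h.acc_partner _))
  womanSingle j := by
    constructor
    · intro hj k _ hk
      have h1 := (partner_woman_iff h.1 j _).mpr hj
      have h2 := (partner_woman_iff h.1 j _).mpr hk
      rw [h1] at h2
      simp [m, w] at h2
    · intro hj
      have h1 := (partner_woman_iff h.1 j _).mp rfl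
      rcases shape_woman h.1.1 h1 with he | ⟨i, he⟩
      · rw [he] at h1; exact h1
      · exact absurd (he ▸ h1) (hj i (he ▸ h.acc_partner _))

theorem IsCandidate.man_acc {P : Instance n p} {A : Set (Person n p × Person n p)}
    (h : IsCandidate P A) {i : Fin n} {y : Person n p} (hy : (m i, y) ∈ A) : P.Acc (m i) y := by
  rcases shape_man h.shape hy with rfl | ⟨j, rfl⟩
  · exact P.acc_self _
  · exact ((h.couple i j).mp hy).1.1

theorem IsCandidate.woman_acc {P : Instance n p} {A : Set (Person n p × Person n p)}
    (h : IsCandidate P A) {j : Fin p} {y : Person n p} (hy : (y, w j) ∈ A) : P.Acc (w j) y := by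
  rcases shape_woman h.shape hy with rfl | ⟨i, rfl⟩
  · exact P.acc_self _
  · exact ((h.couple i j).mp hy).2.1

/-- Of two accepted women, the one liked at least as much as the other refutes the proposal to that
other; this also settles ties, because proposals exclude tied alternatives. -/
theorem IsCandidate.man_unique {P : Instance n p} {A : Set (Person n p × Person n p)}
    (h : IsCandidate P A) {i : Fin n} {y z : Person n p} (hy : (m i, y) ∈ A)
    (hz : (m i, z) ∈ A) : y = z := by
  have hya := h.man_acc hy
  have hza := h.man_acc hz
  rcases shape_man h.shape hy with rfl | ⟨j, rfl⟩ <;>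
    rcases shape_man h.shape hz with rfl | ⟨k, rfl⟩
  · rfl
  · exact absurd hz ((h.manSingle i).mp hy k hza)
  · exact absurd hy ((h.manSingle i).mp hz j hya)
  · by_contra hne
    rcases le_total (P.pos (m i) (w j)) (P.pos (m i) (w k)) with hle | hle
    · exact ((h.couple i k).mp hz).1.2 _ ⟨hya, hza, hle⟩ hne hy
    · exact ((h.couple i j).mp hy).1.2 _ ⟨hza, hya, hle⟩ (Ne.symm hne) hz

theorem IsCandidate.woman_unique {P : Instance n p} {A : Set (Person n p × Person n p)}
    (h : IsCandidate P A) {j : Fin p} {y z : Person n p} (hy : (y, w j) ∈ A)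
    (hz : (z, w j) ∈ A) : y = z := by
  have hya := h.woman_acc hy
  have hza := h.woman_acc hz
  rcases shape_woman h.shape hy with rfl | ⟨i, rfl⟩ <;>
    rcases shape_woman h.shape hz with rfl | ⟨k, rfl⟩
  · rfl
  · exact absurd hz ((h.womanSingle j).mp hy k hza)
  · exact absurd hy ((h.womanSingle j).mp hz i hya)
  · by_contra hne
    rcases le_total (P.pos (w j) (m i)) (P.pos (w j) (m k)) with hle | hle
    · exact ((h.couple k j).mp hz).2.2 _ ⟨hya, hza, hle⟩ hne hy
    · exact ((h.couple i j).mp hy).2.2 _ ⟨hza, hya, hle⟩ (Ne.symm hne) hz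

theorem IsCandidate.isMarriages {P : Instance n p} {A : Set (Person n p × Person n p)}
    (h : IsCandidate P A) : IsMarriages A := by
  refine ⟨h.shape, ?_⟩
  rintro (i | j)
  · obtain ⟨y, hy⟩ : ∃ y, (m i, y) ∈ A := by
      by_cases hs : (m i, m i) ∈ A
      · exact ⟨_, hs⟩
      · rw [h.manSingle] at hs
        push Not at hs
        obtain ⟨k, _, hk⟩ := hs
        exact ⟨_, hk⟩
    refine ⟨(m i, y), ⟨hy, Or.inl rfl⟩, ?_⟩
    rintro ⟨a, b⟩ ⟨hab, hx⟩
    simp only at hx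
    rcases hx with rfl | rfl
    · exact Prod.ext rfl (h.man_unique hab hy)
    · obtain rfl := shape_man_right h.shape hab
      exact Prod.ext rfl (h.man_unique hab hy)
  · obtain ⟨y, hy⟩ : ∃ y, (y, w j) ∈ A := by
      by_cases hs : (w j, w j) ∈ A
      · exact ⟨_, hs⟩
      · rw [h.womanSingle] at hs
        push Not at hs
        obtain ⟨k, _, hk⟩ := hs
        exact ⟨_, hk⟩
    refine ⟨(y, w j), ⟨hy, Or.inr rfl⟩, ?_⟩
    rintro ⟨a, b⟩ ⟨hab, hx⟩
    simp only at hx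
    rcases hx with rfl | rfl
    · obtain rfl := shape_woman_left h.shape hab
      exact Prod.ext (h.woman_unique hab hy) rfl
    · exact Prod.ext (h.woman_unique hab hy) rfl

/-- In a blocking pair each side strictly prefers the other to the only accepted partner, so nothing
accepted obstructs either proposal; the pair is then accepted, and would have to be strictly better
than itself. -/
theorem IsCandidate.isStable {P : Instance n p} {A : Set (Person n p × Person n p)}
    (h : IsCandidate P A) : IsStable P A := by
  have hM := h.isMarriages
  have hm : ∀ i, (m i, partner A (m i)) ∈ A := fun i => (partner_man_iff hM i _).mp rfl
  have hw : ∀ j, (partner A (w j), w j) ∈ A := fun j => (partner_woman_iff hM j _).mp rfl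
  refine ⟨hM, ?_, ?_⟩
  · rintro i j ⟨h1, h2⟩
    have ha : P.Acc (m i) (w j) := le_trans (le_of_lt h1) (h.man_acc (hm i))
    have hb : P.Acc (w j) (m i) := le_trans (le_of_lt h2) (h.woman_acc (hw j))
    have hij : (m i, w j) ∈ A := by
      rw [h.couple]
      refine ⟨⟨ha, fun z hz _ hzA => ?_⟩, ⟨hb, fun z hz _ hzA => ?_⟩⟩
      · rw [← (partner_man_iff hM i z).mpr hzA] at hz
        exact absurd hz.2.2 (not_le.mpr h1)
      · rw [← (partner_woman_iff hM j z).mpr hzA] at hz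
        exact absurd hz.2.2 (not_le.mpr h2)
    rw [(partner_man_iff hM i _).mpr hij] at h1
    exact lt_irrefl _ h1
  · rintro (i | j)
    · rw [Instance.Lt, P.pos_self, not_lt]
      exact h.man_acc (hm i)
    · rw [Instance.Lt, P.pos_self, not_lt]
      exact h.woman_acc (hw j)

/-! ## Criterion values and their successive computation -/

section Tails

variable {ι : Type} [Fintype ι]

/-- The sum of the values whose index is at least `a`. -/
def tailSum (idx f : ι → ℕ) (a : ℕ) : ℕ := ∑ x with a ≤ idx x, f x

/-- The maximum of the values whose index is at least `a`. -/
def tailSup (idx f : ι → ℕ) (a : ℕ) : ℕ := (Finset.univ.filter fun x => a ≤ idx x).sup f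

/-- By injectivity `x` is the only element with its own index. This peels one term off a tail and is
the source of both recursions below. -/
theorem filter_idx_le {idx : ι → ℕ} (h : idx.Injective) [DecidableEq ι] (x : ι) :
    (Finset.univ.filter fun y => idx x ≤ idx y) =
      insert x (Finset.univ.filter fun y => idx x + 1 ≤ idx y) := by
  ext y
  simp only [Finset.mem_filter, Finset.mem_univ, true_and, Finset.mem_insert]
  constructor
  · intro hy
    rcases hy.eq_or_lt with he | hl
    · exact Or.inl (h he.symm)
    · exact Or.inr hl
  · rintro (rfl | hy) <;> omega

theorem tailSum_idx {idx : ι → ℕ} (h : idx.Injective) (f : ι → ℕ) (x : ι) :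
    tailSum idx f (idx x) = tailSum idx f (idx x + 1) + f x := by
  classical
  rw [tailSum, filter_idx_le h, Finset.sum_insert (by simp), add_comm, tailSum]

theorem tailSup_idx {idx : ι → ℕ} (h : idx.Injective) (f : ι → ℕ) (x : ι) :
    tailSup idx f (idx x) = max (tailSup idx f (idx x + 1)) (f x) := by
  classical
  rw [tailSup, filter_idx_le h, Finset.sup_insert, sup_comm, tailSup]

theorem filter_idx_eq_empty {idx : ι → ℕ} {N : ℕ} (h : ∀ x, idx x ≤ N) :
    (Finset.univ.filter fun x => N + 1 ≤ idx x) = ∅ := by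
  ext x
  have := h x
  simp only [Finset.mem_filter, Finset.mem_univ, true_and, Finset.notMem_empty, iff_false]
  omega

theorem tailSum_last {idx : ι → ℕ} (h : idx.Injective) (f : ι → ℕ) {N : ℕ}
    (hN : ∀ x, idx x ≤ N) {x : ι} (hx : idx x = N) : tailSum idx f N = f x := by
  have := tailSum_idx h f x
  rw [hx] at this
  rw [this, tailSum, filter_idx_eq_empty hN, Finset.sum_empty, zero_add]

theorem tailSup_last {idx : ι → ℕ} (h : idx.Injective) (f : ι → ℕ) {N : ℕ}
    (hN : ∀ x, idx x ≤ N) {x : ι} (hx : idx x = N) : tailSup idx f N = f x := by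
  have := tailSup_idx h f x
  rw [hx] at this
  rw [this, tailSup, filter_idx_eq_empty hN, Finset.sup_empty]
  simp

theorem tailSum_one {idx : ι → ℕ} (h : ∀ x, 1 ≤ idx x) (f : ι → ℕ) :
    tailSum idx f 1 = ∑ x, f x := by
  rw [tailSum, Finset.filter_true_of_mem fun x _ => h x]

theorem tailSup_one {idx : ι → ℕ} (h : ∀ x, 1 ≤ idx x) (f : ι → ℕ) :
    tailSup idx f 1 = Finset.univ.sup f := by
  rw [tailSup, Finset.filter_true_of_mem fun x _ => h x]

end Tails

/-- Downward induction common to the sum, maximum and counting rules: `c` is the predicate of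
individual values, `s` that of partial results, `t` the intended partial result. The base case is
the last index `N`, not the empty tail, because the programs start from the value of the last
person. -/
theorem derive_tail {ι : Type} {idx f : ι → ℕ} {t : ℕ → ℕ} {op : ℕ → ℕ → ℕ} {N : ℕ} (hN : 1 ≤ N)
    (hsurj : ∀ a, 1 ≤ a → a ≤ N → ∃ x, idx x = a)
    (hlast : ∀ x, idx x = N → t N = f x)
    (hstep : ∀ x, t (idx x) = op (t (idx x + 1)) (f x))
    {c s : ℕ → ℕ → Prop} (hc : ∀ x, c (idx x) (f x)) (h₁ : ∀ x, c N x → s N x)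
    (h₂ : ∀ J x y, s (J + 1) x → c J y → s J (op x y)) : s 1 (t 1) := by
  refine Nat.decreasingInduction (n := N) (motive := fun a _ => 1 ≤ a → s a (t a))
    ?_ ?_ hN le_rfl
  · intro a ha ih ha1
    obtain ⟨x, hx⟩ := hsurj a ha1 ha.le
    have := hstep x
    have h3 := hc x
    rw [hx] at this h3
    rw [this]
    exact h₂ _ _ _ (ih (by omega)) h3
  · intro hN
    obtain ⟨x, hx⟩ := hsurj N hN le_rfl
    have h3 := hc x
    rw [hx] at h3
    rw [hlast x hx]
    exact h₁ _ h3

/-- The `1`-based number of an element of `Fin q`. -/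
def finIdx {q : ℕ} (i : Fin q) : ℕ := i + 1

theorem finIdx_injective {q : ℕ} : (finIdx (q := q)).Injective := by
  intro a b h
  simp only [finIdx] at h
  exact Fin.ext (by omega)

theorem one_le_finIdx {q : ℕ} (i : Fin q) : 1 ≤ finIdx i := by simp [finIdx]

theorem finIdx_le {q : ℕ} (i : Fin q) : finIdx i ≤ q := by
  have := i.2
  simp only [finIdx]
  omega

theorem exists_finIdx {q a : ℕ} (h₁ : 1 ≤ a) (h₂ : a ≤ q) : ∃ i : Fin q, finIdx i = a :=
  ⟨⟨a - 1, by omega⟩, by simp only [finIdx]; omega⟩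

/-- The number of a person, the women being numbered first. -/
def personIdx : Person n p → ℕ
  | Sum.inl i => p + (i + 1)
  | Sum.inr j => j + 1

theorem personIdx_injective : (personIdx (n := n) (p := p)).Injective := by
  rintro (a | a) (b | b) h <;> simp only [personIdx] at h
  · exact congrArg _ (Fin.ext (by omega))
  · omega
  · omega
  · exact congrArg _ (Fin.ext (by omega))

theorem one_le_personIdx (x : Person n p) : 1 ≤ personIdx x := by
  cases x <;> simp only [personIdx] <;> omega

theorem personIdx_le (x : Person n p) : personIdx x ≤ n + p := by
  cases x <;> simp only [personIdx] <;> omega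

theorem exists_personIdx {a : ℕ} (h₁ : 1 ≤ a) (h₂ : a ≤ n + p) :
    ∃ x : Person n p, personIdx x = a := by
  by_cases h : a ≤ p
  · exact ⟨w ⟨a - 1, by omega⟩, by simp only [personIdx]; omega⟩
  · exact ⟨m ⟨a - p - 1, by omega⟩, by simp only [personIdx]; omega⟩

/-- The cost of the partner of a man. -/
noncomputable def manCost (P : Instance n p) (κ : CostConvention)
    (A : Set (Person n p × Person n p)) (i : Fin n) : ℕ := cost P κ (m i) (partner A (m i))

/-- The cost of the partner of a woman. -/
noncomputable def womanCost (P : Instance n p) (κ : CostConvention)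
    (A : Set (Person n p × Person n p)) (j : Fin p) : ℕ := cost P κ (w j) (partner A (w j))

open Classical in
/-- The indicator of being single. -/
noncomputable def singleCost (A : Set (Person n p × Person n p)) (x : Person n p) : ℕ :=
  if (x, x) ∈ A then 1 else 0

/-- The value for a group of persons with the given costs. -/
def groupValue (c : Criterion) {q : ℕ} (f : Fin q → ℕ) : ℕ :=
  match c with
  | .regret => Finset.univ.sup f
  | _ => ∑ i, f i

/-- The criterion value computed from the values for the men and for the women. -/
def combine (c : Criterion) (x y : ℕ) : ℕ :=
  match c with
  | .sexeq => (x - y) + (y - x)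
  | .regret => max x y
  | _ => x + y

/-- For `sexeq`, one of the two truncated differences in `combine` vanishes and the other is the
absolute value; the other cases split a sum or a maximum over the disjoint union of men and women.
-/
theorem critCost_eq_combine (P : Instance n p) (κ : CostConvention) {c : Criterion}
    (hc : c ≠ .singles) (A : Set (Person n p × Person n p)) :
    critCost P κ c A = combine c (groupValue c (manCost P κ A)) (groupValue c (womanCost P κ A)) := by
  cases c with
  | sexeq =>
    simp only [critCost, combine, groupValue, manCost, womanCost]
    rw [← Nat.cast_sum, ← Nat.cast_sum]
    omega
  | weight => simp [critCost, combine, groupValue, manCost, womanCost, Fintype.sum_sum_type]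
  | regret =>
    simp only [critCost, combine, groupValue]
    apply le_antisymm
    · refine Finset.sup_le ?_
      rintro (i | j) _
      · exact le_trans (Finset.le_sup (f := fun i => cost P κ (m i) (partner A (m i)))
          (Finset.mem_univ i)) (le_max_left _ _)
      · exact le_trans (Finset.le_sup (f := fun j => cost P κ (w j) (partner A (w j)))
          (Finset.mem_univ j)) (le_max_right _ _)
    · refine max_le (Finset.sup_le fun i _ => ?_) (Finset.sup_le fun j _ => ?_)
      · exact Finset.le_sup (f := fun x => cost P κ x (partner A x)) (Finset.mem_univ (m i))
      · exact Finset.le_sup (f := fun x => cost P κ x (partner A x)) (Finset.mem_univ (w j))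
  | singles => exact absurd rfl hc

theorem critCost_singles (P : Instance n p) (κ : CostConvention)
    (A : Set (Person n p × Person n p)) :
    critCost P κ .singles A = ∑ x, singleCost A x := by
  classical
  simp only [critCost, singleCost, Finset.sum_boole, Nat.cast_id]
  rw [← Set.ncard_coe_finset]
  congr 1
  ext x
  simp

/-! ### Arithmetic rules and aggregates as functions -/

/-- For each criterion with combining rules, the side conditions cover all pairs `(x, y)`, and where
they overlap (`sexeq` with `x = y`) the heads agree. Hence there is effectively one rule per pair.
-/
theorem combineRule_iff {man woman crit : ℕ → Atom n p} {c : Criterion} {r : Rule (Atom n p)} :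
    CombineRule man woman crit c r ↔ c ≠ .singles ∧
      ∃ x y, r = { head := {crit (combine c x y)}, pos := {man x, woman y} } := by
  constructor
  · intro h
    cases h with
    | sexeq₁ x y z h =>
      obtain rfl : z = combine .sexeq x y := by simp only [combine]; omega
      exact ⟨by simp, x, y, rfl⟩
    | sexeq₂ x y z h =>
      obtain rfl : z = combine .sexeq x y := by simp only [combine]; omega
      exact ⟨by simp, x, y, rfl⟩
    | weight x y z h => exact ⟨by simp, x, y, by rw [h]; rfl⟩
    | regret₁ x y h => exact ⟨by simp, x, y, by rw [combine, max_eq_left h.le]⟩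
    | regret₂ x y h => exact ⟨by simp, x, y, by rw [combine, max_eq_right h]⟩
  · rintro ⟨hc, x, y, rfl⟩
    cases c with
    | sexeq =>
      rcases le_total x y with h | h
      · exact CombineRule.sexeq₂ x y _ (by simp only [combine]; omega)
      · exact CombineRule.sexeq₁ x y _ (by simp only [combine]; omega)
    | weight => exact CombineRule.weight x y _ rfl
    | regret =>
      rcases le_or_gt x y with h | h
      · rw [combine, max_eq_right h]
        exact CombineRule.regret₂ x y h
      · rw [combine, max_eq_left h.le]
        exact CombineRule.regret₁ x y h
    | singles => exact absurd rfl hc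

/-- The aggregate sums over tuples that carry the person's index, so equal costs of different
persons are counted separately; this is the injectivity `hinj`. -/
theorem sumAgg_iff {q : ℕ} {f : ℕ → ℕ → Atom n p} {g : Fin q → ℕ} {I : Set (Atom n p)}
    (h : ∀ a b, f a b ∈ I ↔ ∃ i : Fin q, a = i + 1 ∧ b = g i) (z : ℕ) :
    SumAgg f z I ↔ z = ∑ i, g i := by
  have hset : {t : ℕ × ℕ | f t.2 t.1 ∈ I} = Set.range fun i : Fin q => (g i, finIdx i) := by
    ext ⟨b, a⟩
    simp only [Set.mem_ofPred_eq, h, Set.mem_range, Prod.mk.injEq, finIdx]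
    exact exists_congr fun i => by rw [and_comm, eq_comm (a := b), eq_comm (a := a)]
  have hinj : Function.Injective fun i : Fin q => (g i, finIdx i) :=
    fun a b hab => finIdx_injective (Prod.ext_iff.mp hab).2
  rw [SumAgg, hset, finsum_mem_range hinj, finsum_eq_sum_of_fintype, eq_comm (a := z)]
  simp [Set.finite_range]

theorem maxAgg_iff {q : ℕ} (hq : 0 < q) {f : ℕ → ℕ → Atom n p} {g : Fin q → ℕ}
    {I : Set (Atom n p)} (h : ∀ a b, f a b ∈ I ↔ ∃ i : Fin q, a = i + 1 ∧ b = g i) (z : ℕ) :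
    MaxAgg f z I ↔ z = Finset.univ.sup g := by
  have hset : {B | ∃ A, f A B ∈ I} = Set.range g := by
    ext b
    simp only [Set.mem_ofPred_eq, h, Set.mem_range]
    constructor
    · rintro ⟨a, i, _, rfl⟩
      exact ⟨i, rfl⟩
    · rintro ⟨i, rfl⟩
      exact ⟨_, i, rfl, rfl⟩
  have hmax : IsGreatest (Set.range g) (Finset.univ.sup g) := by
    constructor
    -- Attainment needs at least one person: with none, the supremum would be the default `0` while
    -- no greatest element exists.
    · have : Nonempty (Fin q) := ⟨⟨0, hq⟩⟩
      obtain ⟨i, _, hi⟩ := Finset.exists_mem_eq_sup Finset.univ Finset.univ_nonempty g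
      exact ⟨i, hi.symm⟩
    · rintro _ ⟨i, rfl⟩
      exact Finset.le_sup (Finset.mem_univ i)
  rw [MaxAgg, hset]
  exact ⟨fun hz => hz.unique hmax, fun hz => hz ▸ hmax⟩

/-! ## Answer sets -/

section General

variable {α : Type}

theorem isModel_reduct_iff {Q : Program α} {I J : Set α} :
    IsModel (reduct Q I) J ↔ ∀ r ∈ Q, r.neg ∩ I = ∅ → r.agg I → r.pos ⊆ J → r.agg J →
      ∃ a ∈ r.head, a ∈ J := by
  constructor
  · intro h r hr hn ha hp hJ
    exact h ⟨r.head, r.pos, ∅, r.agg⟩ ⟨r, hr, hn, ha, rfl⟩ hp hJ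
  · rintro h _ ⟨r, hr, hn, ha, rfl⟩ hp hJ
    exact h r hr hn ha hp hJ

theorem IsAnswerSet.model {Q : Program α} {I : Set α} (h : IsAnswerSet Q I) {r : Rule α}
    (hr : r ∈ Q) (hn : r.neg ∩ I = ∅) (ha : r.agg I) (hp : r.pos ⊆ I) : ∃ a ∈ r.head, a ∈ I :=
  isModel_reduct_iff.mp h.1 r hr hn ha hp ha

/-- Every atom of an answer set is supported by a rule. -/
theorem IsAnswerSet.supported {Q : Program α} {I : Set α} (h : IsAnswerSet Q I) {a : α}
    (ha : a ∈ I) : ∃ r ∈ Q, a ∈ r.head ∧ r.neg ∩ I = ∅ ∧ r.agg I ∧ r.pos ⊆ I := by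
  -- Deleting only `a` must break a rule of the reduct; `I` satisfies that rule, so `a` is the head
  -- atom that was lost.
  have hlt : I \ {a} ⊂ I := Set.sdiff_singleton_ssubset.mpr ha
  have := h.2 _ hlt
  rw [isModel_reduct_iff] at this
  push Not at this
  obtain ⟨r, hr, hn, hI, hp, -, hhead⟩ := this
  have hp' : r.pos ⊆ I := hp.trans Set.sdiff_subset
  obtain ⟨b, hb, hbI⟩ := h.model hr hn hI hp'
  have hba : b = a := by
    by_contra hne
    exact hhead b hb ⟨hbI, hne⟩
  exact ⟨r, hr, hba ▸ hb, hn, hI, hp'⟩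

/-- The atoms derivable from the atoms in `B` by the definite rules of `Q`. -/
inductive Consequence (Q : Program α) (B : Set α) : α → Prop
  | base {a : α} (h : a ∈ B) : Consequence Q B a
  | step {r : Rule α} {a : α} (hr : r ∈ Q) (hhead : r.head = {a}) (hneg : r.neg = ∅)
      (hagg : ∀ X, r.agg X) (hpos : ∀ b ∈ r.pos, Consequence Q B b) : Consequence Q B a

/-- Rules without negation and with always true aggregates survive every reduct, so each of its
models is closed under them. -/
theorem Consequence.mem {Q Q' : Program α} {B I J : Set α} (hQ : Q' ⊆ Q)
    (hJ : IsModel (reduct Q I) J) (hB : B ⊆ J) {a : α} (h : Consequence Q' B a) : a ∈ J := by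
  induction h with
  | base h => exact hB h
  | step hr hhead hneg hagg _ ih =>
    obtain ⟨b, hb, hbJ⟩ := isModel_reduct_iff.mp hJ _ (hQ hr) (by simp [hneg]) (hagg I) ih (hagg J)
    rw [hhead] at hb
    rwa [← Set.mem_singleton_iff.mp hb]

end General

/-! ## The first candidate -/

open Atom

/-- The atoms of the normal program and of the computation of its criterion value. -/
def Unprimed : Atom n p → Prop
  | accept _ _ | manpropose _ _ | womanpropose _ _ | mancost _ _ | womancost _ _ | manweight _
  | womanweight _ | manregret _ | womanregret _ | crit _ _ => True
  | _ => False

/-- A level mapping for the positive and aggregate dependencies of the unprimed atoms. -/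
def level : Atom n p → ℕ
  | accept _ _ => 1
  | mancost _ _ | womancost _ _ => 2
  | manweight _ | womanweight _ | manregret _ | womanregret _ => 3
  | crit _ _ => 4
  | _ => 0

/-- The predicate for the value for the men. -/
def manValueAtom (c : Criterion) : ℕ → Atom n p :=
  match c with
  | .regret => manregret
  | _ => manweight

/-- The predicate for the value for the women. -/
def womanValueAtom (c : Criterion) : ℕ → Atom n p :=
  match c with
  | .regret => womanregret
  | _ => womanweight

theorem mem_extProgram {P : Instance n p} {κ : CostConvention} {c : Criterion}
    {r : Rule (Atom n p)} : r ∈ extProgram P κ c ↔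
      NormRule P r ∨ (c ≠ .singles ∧ CostRule P κ r) ∨
      ((c = .sexeq ∨ c = .weight) ∧ WeightRule r) ∨ (c = .regret ∧ RegretRule r) ∨
      (c = .singles ∧ SinglesRule r) ∨
      (c ≠ .singles ∧ ∃ x y, r =
        { head := {crit c (combine c x y)}, pos := {manValueAtom c x, womanValueAtom c y} }) := by
  cases c <;> simp [extProgram, combineRule_iff, manValueAtom, womanValueAtom, or_assoc]

/-- Acyclicity of group 1. Aggregates must also depend only on lower levels, because the reduct
keeps them and they are evaluated again in the smaller model. Negative literals need no level: the
reduct fixes them in `I`. -/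
theorem level_lt {P : Instance n p} {κ : CostConvention} {c : Criterion}
    {r : Rule (Atom n p)} (hr : r ∈ extProgram P κ c) : ∃ a, r.head = {a} ∧ Unprimed a ∧
      (∀ b ∈ r.pos, Unprimed b ∧ level b < level a) ∧
      ∀ I J : Set (Atom n p), (∀ b, Unprimed b → level b < level a → (b ∈ I ↔ b ∈ J)) →
        r.agg I → r.agg J := by
  rw [mem_extProgram] at hr
  rcases hr with h | ⟨-, h⟩ | ⟨-, h⟩ | ⟨-, h⟩ | ⟨-, h⟩ | ⟨-, x, y, rfl⟩
  · cases h <;> exact ⟨_, rfl, trivial, by simp [Unprimed, level], fun _ _ _ h => h⟩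
  · cases h <;> exact ⟨_, rfl, trivial, by simp [Unprimed, level], fun _ _ _ h => h⟩
  · cases h with
    | manweight z =>
      refine ⟨_, rfl, trivial, by simp, fun I J h => ?_⟩
      have h' : ∀ a b, mancost a b ∈ I ↔ mancost a b ∈ J :=
        fun a b => h _ trivial (by simp [level])
      simp only [SumAgg, h', imp_self]
    | womanweight z =>
      refine ⟨_, rfl, trivial, by simp, fun I J h => ?_⟩
      have h' : ∀ a b, womancost a b ∈ I ↔ womancost a b ∈ J :=
        fun a b => h _ trivial (by simp [level])
      simp only [SumAgg, h', imp_self]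
  · cases h with
    | manregret z =>
      refine ⟨_, rfl, trivial, by simp, fun I J h => ?_⟩
      have h' : ∀ a b, mancost a b ∈ I ↔ mancost a b ∈ J :=
        fun a b => h _ trivial (by simp [level])
      simp only [MaxAgg, h', imp_self]
    | womanregret z =>
      refine ⟨_, rfl, trivial, by simp, fun I J h => ?_⟩
      have h' : ∀ a b, womancost a b ∈ I ↔ womancost a b ∈ J :=
        fun a b => h _ trivial (by simp [level])
      simp only [MaxAgg, h', imp_self]
  · cases h with
    | singles z =>
      refine ⟨_, rfl, trivial, by simp, fun I J h => ?_⟩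
      have h' : ∀ a b, accept a b ∈ I ↔ accept a b ∈ J :=
        fun a b => h _ trivial (by simp [level])
      simp only [CountAgg, h', imp_self]
  · refine ⟨_, rfl, trivial, ?_, fun _ _ _ h => h⟩
    cases c <;> simp [Unprimed, level, manValueAtom, womanValueAtom]

/-- Some rule of the normal program with head `a` has a body that is true in `I`. -/
def Fires (P : Instance n p) (κ : CostConvention) (c : Criterion) (I : Set (Atom n p))
    (a : Atom n p) : Prop :=
  ∃ r ∈ extProgram P κ c, r.head = {a} ∧ r.neg ∩ I = ∅ ∧ r.agg I ∧ r.pos ⊆ I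

/-- This lemma and its analogues below write out the completion of group 1 predicate by predicate.
-/
theorem fires_accept {P : Instance n p} {κ : CostConvention} {c : Criterion}
    {I : Set (Atom n p)} {x y : Person n p} : Fires P κ c I (accept x y) ↔
      (∃ i j, x = m i ∧ y = w j ∧ manpropose (m i) (w j) ∈ I ∧ womanpropose (m i) (w j) ∈ I) ∨
      (∃ i, x = m i ∧ y = m i ∧ ∀ k, P.Acc (m i) (w k) → accept (m i) (w k) ∉ I) ∨
      (∃ j, x = w j ∧ y = w j ∧ ∀ k, P.Acc (w j) (m k) → accept (m k) (w j) ∉ I) := by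
  constructor
  · rintro ⟨r, hr, hhead, hneg, hagg, hpos⟩
    rw [mem_extProgram] at hr
    rcases hr with h | ⟨-, h⟩ | ⟨-, h⟩ | ⟨-, h⟩ | ⟨-, h⟩ | ⟨-, x, y, rfl⟩
    · cases h <;> simp at hhead
      · obtain ⟨rfl, rfl⟩ := hhead
        exact Or.inl ⟨_, _, rfl, rfl, hpos (by simp), hpos (by simp)⟩
      · obtain ⟨rfl, rfl⟩ := hhead
        refine Or.inr (Or.inl ⟨_, rfl, rfl, fun k hk hI => ?_⟩)
        exact (Set.eq_empty_iff_forall_notMem.mp hneg) _ ⟨⟨k, hk, rfl⟩, hI⟩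
      · obtain ⟨rfl, rfl⟩ := hhead
        refine Or.inr (Or.inr ⟨_, rfl, rfl, fun k hk hI => ?_⟩)
        exact (Set.eq_empty_iff_forall_notMem.mp hneg) _ ⟨⟨k, hk, rfl⟩, hI⟩
    all_goals first | (cases h <;> simp at hhead) | simp at hhead
  · rintro (⟨i, j, rfl, rfl, h1, h2⟩ | ⟨i, rfl, rfl, h⟩ | ⟨j, rfl, rfl, h⟩)
    · refine ⟨_, mem_extProgram.mpr (Or.inl (NormRule.accept i j)), rfl, by simp, trivial, ?_⟩
      rintro _ (rfl | rfl) <;> assumption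
    · refine ⟨_, mem_extProgram.mpr (Or.inl (NormRule.manSingle i)), rfl, ?_, trivial, by simp⟩
      rw [Set.eq_empty_iff_forall_notMem]
      rintro _ ⟨⟨k, hk, rfl⟩, hI⟩
      exact h k hk hI
    · refine ⟨_, mem_extProgram.mpr (Or.inl (NormRule.womanSingle j)), rfl, ?_, trivial, by simp⟩
      rw [Set.eq_empty_iff_forall_notMem]
      rintro _ ⟨⟨k, hk, rfl⟩, hI⟩
      exact h k hk hI

theorem fires_manpropose {P : Instance n p} {κ : CostConvention} {c : Criterion}
    {I : Set (Atom n p)} {x y : Person n p} : Fires P κ c I (manpropose x y) ↔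
      ∃ i j, x = m i ∧ y = w j ∧ ManProposes P (acceptedPairs I) (m i) (w j) := by
  constructor
  · rintro ⟨r, hr, hhead, hneg, hagg, hpos⟩
    rw [mem_extProgram] at hr
    rcases hr with h | ⟨-, h⟩ | ⟨-, h⟩ | ⟨-, h⟩ | ⟨-, h⟩ | ⟨-, x, y, rfl⟩
    · cases h with
      | manpropose i j ha =>
        simp at hhead
        obtain ⟨rfl, rfl⟩ := hhead
        refine ⟨i, j, rfl, rfl, ha, fun z hz hne hI => ?_⟩
        exact (Set.eq_empty_iff_forall_notMem.mp hneg) _ ⟨⟨z, hz, hne, rfl⟩, hI⟩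
      | _ => simp at hhead
    all_goals first | (cases h <;> simp at hhead) | simp at hhead
  · rintro ⟨i, j, rfl, rfl, ha, h⟩
    refine ⟨_, mem_extProgram.mpr (Or.inl (NormRule.manpropose i j ha)), rfl, ?_, trivial, by simp⟩
    rw [Set.eq_empty_iff_forall_notMem]
    rintro _ ⟨⟨z, hz, hne, rfl⟩, hI⟩
    exact h z hz hne hI

theorem fires_womanpropose {P : Instance n p} {κ : CostConvention} {c : Criterion}
    {I : Set (Atom n p)} {x y : Person n p} : Fires P κ c I (womanpropose x y) ↔
      ∃ i j, x = m i ∧ y = w j ∧ WomanProposes P (acceptedPairs I) (m i) (w j) := by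
  constructor
  · rintro ⟨r, hr, hhead, hneg, hagg, hpos⟩
    rw [mem_extProgram] at hr
    rcases hr with h | ⟨-, h⟩ | ⟨-, h⟩ | ⟨-, h⟩ | ⟨-, h⟩ | ⟨-, x, y, rfl⟩
    · cases h with
      | womanpropose i j ha =>
        simp at hhead
        obtain ⟨rfl, rfl⟩ := hhead
        refine ⟨i, j, rfl, rfl, ha, fun z hz hne hI => ?_⟩
        exact (Set.eq_empty_iff_forall_notMem.mp hneg) _ ⟨⟨z, hz, hne, rfl⟩, hI⟩
      | _ => simp at hhead
    all_goals first | (cases h <;> simp at hhead) | simp at hhead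
  · rintro ⟨i, j, rfl, rfl, ha, h⟩
    refine ⟨_, mem_extProgram.mpr (Or.inl (NormRule.womanpropose i j ha)), rfl, ?_, trivial,
      by simp⟩
    rw [Set.eq_empty_iff_forall_notMem]
    rintro _ ⟨⟨z, hz, hne, rfl⟩, hI⟩
    exact h z hz hne hI

theorem fires_mancost {P : Instance n p} {κ : CostConvention} {c : Criterion}
    {I : Set (Atom n p)} {a b : ℕ} : Fires P κ c I (mancost a b) ↔ c ≠ .singles ∧
      ((∃ i : Fin n, ∃ j, a = i + 1 ∧ b = cost P κ (m i) (w j) ∧ P.Acc (m i) (w j) ∧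
        accept (m i) (w j) ∈ I) ∨
      (∃ i : Fin n, a = i + 1 ∧ b = cost P κ (m i) (m i) ∧ accept (m i) (m i) ∈ I)) := by
  constructor
  · rintro ⟨r, hr, hhead, hneg, hagg, hpos⟩
    rw [mem_extProgram] at hr
    rcases hr with h | ⟨hc, h⟩ | ⟨-, h⟩ | ⟨-, h⟩ | ⟨-, h⟩ | ⟨-, x, y, rfl⟩
    rotate_left
    · refine ⟨hc, ?_⟩
      cases h <;> simp at hhead
      · exact Or.inl ⟨_, _, hhead.1.symm, hhead.2.symm, by assumption, hpos (by simp)⟩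
      · exact Or.inr ⟨_, hhead.1.symm, hhead.2.symm, hpos (by simp)⟩
    all_goals first | (cases h <;> simp at hhead) | simp at hhead
  · rintro ⟨hc, ⟨i, j, rfl, rfl, ha, h⟩ | ⟨i, rfl, rfl, h⟩⟩
    · exact ⟨_, mem_extProgram.mpr (Or.inr (Or.inl ⟨hc, CostRule.mancost i j ha⟩)), rfl, by simp,
        trivial, by simpa using h⟩
    · exact ⟨_, mem_extProgram.mpr (Or.inr (Or.inl ⟨hc, CostRule.mancostSingle i⟩)), rfl, by simp,
        trivial, by simpa using h⟩

theorem fires_womancost {P : Instance n p} {κ : CostConvention} {c : Criterion}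
    {I : Set (Atom n p)} {a b : ℕ} : Fires P κ c I (womancost a b) ↔ c ≠ .singles ∧
      ((∃ j : Fin p, ∃ i, a = j + 1 ∧ b = cost P κ (w j) (m i) ∧ P.Acc (w j) (m i) ∧
        accept (m i) (w j) ∈ I) ∨
      (∃ j : Fin p, a = j + 1 ∧ b = cost P κ (w j) (w j) ∧ accept (w j) (w j) ∈ I)) := by
  constructor
  · rintro ⟨r, hr, hhead, hneg, hagg, hpos⟩
    rw [mem_extProgram] at hr
    rcases hr with h | ⟨hc, h⟩ | ⟨-, h⟩ | ⟨-, h⟩ | ⟨-, h⟩ | ⟨-, x, y, rfl⟩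
    rotate_left
    · refine ⟨hc, ?_⟩
      cases h <;> simp at hhead
      · exact Or.inl ⟨_, _, hhead.1.symm, hhead.2.symm, by assumption, hpos (by simp)⟩
      · exact Or.inr ⟨_, hhead.1.symm, hhead.2.symm, hpos (by simp)⟩
    all_goals first | (cases h <;> simp at hhead) | simp at hhead
  · rintro ⟨hc, ⟨j, i, rfl, rfl, ha, h⟩ | ⟨j, rfl, rfl, h⟩⟩
    · exact ⟨_, mem_extProgram.mpr (Or.inr (Or.inl ⟨hc, CostRule.womancost i j ha⟩)), rfl, by simp,
        trivial, by simpa using h⟩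
    · exact ⟨_, mem_extProgram.mpr (Or.inr (Or.inl ⟨hc, CostRule.womancostSingle j⟩)), rfl,
        by simp, trivial, by simpa using h⟩

theorem fires_manweight {P : Instance n p} {κ : CostConvention} {c : Criterion}
    {I : Set (Atom n p)} {z : ℕ} : Fires P κ c I (manweight z) ↔
      (c = .sexeq ∨ c = .weight) ∧ SumAgg mancost z I := by
  constructor
  · rintro ⟨r, hr, hhead, hneg, hagg, hpos⟩
    rw [mem_extProgram] at hr
    rcases hr with h | ⟨-, h⟩ | ⟨hc, h⟩ | ⟨-, h⟩ | ⟨-, h⟩ | ⟨-, x, y, rfl⟩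
    rotate_left 2
    · cases h <;> simp at hhead
      exact ⟨hc, hhead ▸ hagg⟩
    all_goals first | (cases h <;> simp at hhead) | simp at hhead
  · rintro ⟨hc, h⟩
    exact ⟨_, mem_extProgram.mpr (Or.inr (Or.inr (Or.inl ⟨hc, WeightRule.manweight z⟩))), rfl,
      by simp, h, by simp⟩

theorem fires_womanweight {P : Instance n p} {κ : CostConvention} {c : Criterion}
    {I : Set (Atom n p)} {z : ℕ} : Fires P κ c I (womanweight z) ↔
      (c = .sexeq ∨ c = .weight) ∧ SumAgg womancost z I := by
  constructor
  · rintro ⟨r, hr, hhead, hneg, hagg, hpos⟩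
    rw [mem_extProgram] at hr
    rcases hr with h | ⟨-, h⟩ | ⟨hc, h⟩ | ⟨-, h⟩ | ⟨-, h⟩ | ⟨-, x, y, rfl⟩
    rotate_left 2
    · cases h <;> simp at hhead
      exact ⟨hc, hhead ▸ hagg⟩
    all_goals first | (cases h <;> simp at hhead) | simp at hhead
  · rintro ⟨hc, h⟩
    exact ⟨_, mem_extProgram.mpr (Or.inr (Or.inr (Or.inl ⟨hc, WeightRule.womanweight z⟩))), rfl,
      by simp, h, by simp⟩

theorem fires_manregret {P : Instance n p} {κ : CostConvention} {c : Criterion}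
    {I : Set (Atom n p)} {z : ℕ} : Fires P κ c I (manregret z) ↔
      c = .regret ∧ MaxAgg mancost z I := by
  constructor
  · rintro ⟨r, hr, hhead, hneg, hagg, hpos⟩
    rw [mem_extProgram] at hr
    rcases hr with h | ⟨-, h⟩ | ⟨-, h⟩ | ⟨hc, h⟩ | ⟨-, h⟩ | ⟨-, x, y, rfl⟩
    rotate_left 3
    · cases h <;> simp at hhead
      exact ⟨hc, hhead ▸ hagg⟩
    all_goals first | (cases h <;> simp at hhead) | simp at hhead
  · rintro ⟨hc, h⟩
    exact ⟨_, mem_extProgram.mpr (Or.inr (Or.inr (Or.inr (Or.inl ⟨hc, RegretRule.manregret z⟩)))),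
      rfl, by simp, h, by simp⟩

theorem fires_womanregret {P : Instance n p} {κ : CostConvention} {c : Criterion}
    {I : Set (Atom n p)} {z : ℕ} : Fires P κ c I (womanregret z) ↔
      c = .regret ∧ MaxAgg womancost z I := by
  constructor
  · rintro ⟨r, hr, hhead, hneg, hagg, hpos⟩
    rw [mem_extProgram] at hr
    rcases hr with h | ⟨-, h⟩ | ⟨-, h⟩ | ⟨hc, h⟩ | ⟨-, h⟩ | ⟨-, x, y, rfl⟩
    rotate_left 3
    · cases h <;> simp at hhead
      exact ⟨hc, hhead ▸ hagg⟩
    all_goals first | (cases h <;> simp at hhead) | simp at hhead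
  · rintro ⟨hc, h⟩
    exact ⟨_, mem_extProgram.mpr (Or.inr (Or.inr (Or.inr (Or.inl ⟨hc, RegretRule.womanregret z⟩)))),
      rfl, by simp, h, by simp⟩

theorem fires_crit {P : Instance n p} {κ : CostConvention} {c d : Criterion}
    {I : Set (Atom n p)} {v : ℕ} : Fires P κ c I (crit d v) ↔ d = c ∧
      ((c = .singles ∧ CountAgg v I) ∨ (c ≠ .singles ∧
        ∃ x y, v = combine c x y ∧ manValueAtom c x ∈ I ∧ womanValueAtom c y ∈ I)) := by
  constructor
  · rintro ⟨r, hr, hhead, hneg, hagg, hpos⟩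
    rw [mem_extProgram] at hr
    rcases hr with h | ⟨-, h⟩ | ⟨-, h⟩ | ⟨-, h⟩ | ⟨hc, h⟩ | ⟨hc, x, y, rfl⟩
    rotate_left 4
    · cases h
      simp at hhead
      obtain ⟨rfl, rfl⟩ := hhead
      exact ⟨hc.symm, Or.inl ⟨hc, hagg⟩⟩
    · simp at hhead
      obtain ⟨rfl, rfl⟩ := hhead
      exact ⟨rfl, Or.inr ⟨hc, x, y, rfl, hpos (by simp), hpos (by simp)⟩⟩
    all_goals (cases h <;> simp at hhead)
  · rintro ⟨rfl, ⟨rfl, h⟩ | ⟨hc, x, y, rfl, h1, h2⟩⟩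
    · exact ⟨_, mem_extProgram.mpr (Or.inr (Or.inr (Or.inr (Or.inr (Or.inl
        ⟨rfl, SinglesRule.singles v⟩))))), rfl, by simp, h, by simp⟩
    · refine ⟨_, mem_extProgram.mpr (Or.inr (Or.inr (Or.inr (Or.inr (Or.inr
        ⟨hc, x, y, rfl⟩))))), rfl, by simp, trivial, ?_⟩
      rintro _ (rfl | rfl) <;> assumption

/-- Every unprimed atom of `I` is supported by a rule of the normal program, and conversely. -/
def IsCompletion (P : Instance n p) (κ : CostConvention) (c : Criterion)
    (I : Set (Atom n p)) : Prop := ∀ a, Unprimed a → (a ∈ I ↔ Fires P κ c I a)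

/-! ### Consequences of the completion -/

section Completion

variable {P : Instance n p} {κ : CostConvention} {c : Criterion} {I : Set (Atom n p)}

theorem IsCompletion.isCandidate (h : IsCompletion P κ c I) :
    IsCandidate P (acceptedPairs I) := by
  have hacc : ∀ x y, (x, y) ∈ acceptedPairs I ↔ _ :=
    fun x y => (h (accept x y) trivial).trans fires_accept
  have hm : ∀ i j, manpropose (m i) (w j) ∈ I ↔ ManProposes P (acceptedPairs I) (m i) (w j) := by
    intro i j
    rw [h (manpropose _ _) trivial, fires_manpropose]
    constructor
    · rintro ⟨i', j', hi, hj, h'⟩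
      rwa [hi, hj]
    · exact fun h' => ⟨i, j, rfl, rfl, h'⟩
  have hw : ∀ i j, womanpropose (m i) (w j) ∈ I ↔
      WomanProposes P (acceptedPairs I) (m i) (w j) := by
    intro i j
    rw [h (womanpropose _ _) trivial, fires_womanpropose]
    constructor
    · rintro ⟨i', j', hi, hj, h'⟩
      rwa [hi, hj]
    · exact fun h' => ⟨i, j, rfl, rfl, h'⟩
  refine ⟨?_, ?_, ?_, ?_⟩
  · rintro ⟨x, y⟩ hq
    rw [hacc] at hq
    rcases hq with ⟨i, j, rfl, rfl, -⟩ | ⟨i, rfl, rfl, -⟩ | ⟨j, rfl, rfl, -⟩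
    · exact Or.inr ⟨i, j, rfl⟩
    · exact Or.inl rfl
    · exact Or.inl rfl
  · intro i j
    rw [hacc, ← hm, ← hw]
    simp
  · intro i
    rw [hacc]
    simp [acceptedPairs]
  · intro j
    rw [hacc]
    simp [acceptedPairs]

/-- Each man has exactly one partner, so exactly one of his cost rules fires; `mancost` is the graph
of a function, as the aggregate lemmas require. -/
theorem IsCompletion.mancost_iff (h : IsCompletion P κ c I) (hc : c ≠ .singles) (a b : ℕ) :
    mancost a b ∈ I ↔ ∃ i : Fin n, a = i + 1 ∧ b = manCost P κ (acceptedPairs I) i := by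
  have hA := h.isCandidate
  have hpart := partner_man_iff hA.isMarriages
  rw [h (mancost _ _) trivial, fires_mancost]
  constructor
  · rintro ⟨-, ⟨i, j, rfl, rfl, -, h1⟩ | ⟨i, rfl, rfl, h1⟩⟩
    · exact ⟨i, rfl, by rw [manCost, (hpart i _).mpr h1]⟩
    · exact ⟨i, rfl, by rw [manCost, (hpart i _).mpr h1]⟩
  · rintro ⟨i, rfl, rfl⟩
    have hi := (hpart i _).mp rfl
    refine ⟨hc, ?_⟩
    rcases shape_man hA.shape hi with he | ⟨j, he⟩
    · refine Or.inr ⟨i, rfl, by rw [manCost, he], ?_⟩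
      rw [he] at hi; exact hi
    · refine Or.inl ⟨i, j, rfl, by rw [manCost, he], ?_, ?_⟩
      · rw [he] at hi; exact hA.man_acc hi
      · rw [he] at hi; exact hi

theorem IsCompletion.womancost_iff (h : IsCompletion P κ c I) (hc : c ≠ .singles) (a b : ℕ) :
    womancost a b ∈ I ↔ ∃ j : Fin p, a = j + 1 ∧ b = womanCost P κ (acceptedPairs I) j := by
  have hA := h.isCandidate
  have hpart := partner_woman_iff hA.isMarriages
  rw [h (womancost _ _) trivial, fires_womancost]
  constructor
  · rintro ⟨-, ⟨j, i, rfl, rfl, -, h1⟩ | ⟨j, rfl, rfl, h1⟩⟩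
    · exact ⟨j, rfl, by rw [womanCost, (hpart j _).mpr h1]⟩
    · exact ⟨j, rfl, by rw [womanCost, (hpart j _).mpr h1]⟩
  · rintro ⟨j, rfl, rfl⟩
    have hj := (hpart j _).mp rfl
    refine ⟨hc, ?_⟩
    rcases shape_woman hA.shape hj with he | ⟨i, he⟩
    · refine Or.inr ⟨j, rfl, by rw [womanCost, he], ?_⟩
      rw [he] at hj; exact hj
    · refine Or.inl ⟨j, i, rfl, by rw [womanCost, he], ?_, ?_⟩
      · rw [he] at hj; exact hA.woman_acc hj
      · rw [he] at hj; exact hj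

theorem IsCompletion.manValueAtom_iff (h : IsCompletion P κ c I) (hn : 0 < n)
    (hc : c ≠ .singles) (z : ℕ) :
    manValueAtom c z ∈ I ↔ z = groupValue c (manCost P κ (acceptedPairs I)) := by
  have hcost := h.mancost_iff hc
  cases c with
  | singles => exact absurd rfl hc
  | regret =>
    rw [manValueAtom, h (manregret _) trivial, fires_manregret, maxAgg_iff hn hcost]
    simp [groupValue]
  | _ =>
    rw [manValueAtom, h (manweight _) trivial, fires_manweight, sumAgg_iff hcost]
    all_goals simp [groupValue]

theorem IsCompletion.womanValueAtom_iff (h : IsCompletion P κ c I) (hp : 0 < p)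
    (hc : c ≠ .singles) (z : ℕ) :
    womanValueAtom c z ∈ I ↔ z = groupValue c (womanCost P κ (acceptedPairs I)) := by
  have hcost := h.womancost_iff hc
  cases c with
  | singles => exact absurd rfl hc
  | regret =>
    rw [womanValueAtom, h (womanregret _) trivial, fires_womanregret, maxAgg_iff hp hcost]
    simp [groupValue]
  | _ =>
    rw [womanValueAtom, h (womanweight _) trivial, fires_womanweight, sumAgg_iff hcost]
    all_goals simp [groupValue]

theorem IsCompletion.crit_iff (h : IsCompletion P κ c I) (hn : 0 < n) (hp : 0 < p) (v : ℕ) :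
    crit c v ∈ I ↔ v = critCost P κ c (acceptedPairs I) := by
  rw [h (crit _ _) trivial, fires_crit]
  by_cases hc : c = .singles
  · subst hc
    simp only [true_and, ne_eq, not_true_eq_false, false_and, or_false, CountAgg, critCost,
      acceptedPairs, Set.mem_ofPred_eq]
    exact eq_comm
  · rw [critCost_eq_combine P κ hc]
    simp [hc, h.manValueAtom_iff hn hc, h.womanValueAtom_iff hp hc]

/-- The unprimed part of a model of the reduct cannot be shrunk. -/
theorem IsCompletion.mem_of_isModel (h : IsCompletion P κ c I) {Q : Program (Atom n p)}
    (hQ : extProgram P κ c ⊆ Q) {J : Set (Atom n p)} (hJI : J ⊆ I)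
    (hJ : IsModel (reduct Q I) J) (a : Atom n p) (ha : Unprimed a) (haI : a ∈ I) : a ∈ J := by
  induction hl : level a using Nat.strong_induction_on generalizing a with
  | _ k ih =>
    obtain ⟨r, hr, hhead, hneg, hagg, hpos⟩ := (h a ha).mp haI
    obtain ⟨b, hb, -, hlt, hloc⟩ := level_lt hr
    obtain rfl : a = b := by
      rw [hhead] at hb
      exact Set.singleton_injective hb
    -- The rule that supports `a` in `I` still applies in `J`: its positive body has lower level,
    -- and `I` and `J` agree on the lower unprimed atoms, so the aggregate keeps its truth value.
    obtain ⟨d, hd, hdJ⟩ := isModel_reduct_iff.mp hJ r (hQ hr) hneg hagg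
      (fun e he => ih _ (hl ▸ (hlt e he).2) e (hlt e he).1 (hpos he) rfl)
      (hloc I J (fun e he hle => ⟨fun heI => ih _ (hl ▸ hle) e he heI rfl, fun heJ => hJI heJ⟩)
        hagg)
    rw [hhead] at hd
    rwa [← Set.mem_singleton_iff.mp hd]

end Completion

/-- The unprimed atoms that are true for a stable set of marriages `A`. -/
def candidateAtoms (P : Instance n p) (κ : CostConvention) (c : Criterion)
    (A : Set (Person n p × Person n p)) : Atom n p → Prop
  | accept x y => (x, y) ∈ A
  | manpropose x y => ∃ i j, x = m i ∧ y = w j ∧ ManProposes P A (m i) (w j)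
  | womanpropose x y => ∃ i j, x = m i ∧ y = w j ∧ WomanProposes P A (m i) (w j)
  | mancost a b => c ≠ .singles ∧ ∃ i : Fin n, a = i + 1 ∧ b = manCost P κ A i
  | womancost a b => c ≠ .singles ∧ ∃ j : Fin p, a = j + 1 ∧ b = womanCost P κ A j
  | manweight z => (c = .sexeq ∨ c = .weight) ∧ z = ∑ i, manCost P κ A i
  | womanweight z => (c = .sexeq ∨ c = .weight) ∧ z = ∑ j, womanCost P κ A j
  | manregret z => c = .regret ∧ z = Finset.univ.sup (manCost P κ A)
  | womanregret z => c = .regret ∧ z = Finset.univ.sup (womanCost P κ A)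
  | crit d v => d = c ∧ v = critCost P κ c A
  | _ => False

/-- Converse of the reading above: a solution on the `accept` atoms extends to the whole of group 1
once proposals, costs and values are given their intended meaning. -/
theorem isCompletion_of_candidateAtoms {P : Instance n p} {κ : CostConvention} {c : Criterion}
    {A : Set (Person n p × Person n p)} {I : Set (Atom n p)} (hn : 0 < n) (hp : 0 < p)
    (hA : IsCandidate P A) (hI : ∀ a, Unprimed a → (a ∈ I ↔ candidateAtoms P κ c A a)) :
    IsCompletion P κ c I := by
  have hacc : acceptedPairs I = A := by
    ext ⟨x, y⟩
    exact hI (accept x y) trivial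
  have hacc' : ∀ x y, accept x y ∈ I ↔ (x, y) ∈ A := fun x y => hI (accept x y) trivial
  have hmc : ∀ a b, mancost a b ∈ I ↔ c ≠ .singles ∧ ∃ i : Fin n, a = i + 1 ∧ b = manCost P κ A i :=
    fun a b => hI (mancost a b) trivial
  have hwc : ∀ a b, womancost a b ∈ I ↔
      c ≠ .singles ∧ ∃ j : Fin p, a = j + 1 ∧ b = womanCost P κ A j :=
    fun a b => hI (womancost a b) trivial
  intro a ha
  rw [hI a ha]
  cases a with
  | accept x y =>
    rw [fires_accept]
    simp only [hI (manpropose _ _) trivial, hI (womanpropose _ _) trivial, hacc', candidateAtoms]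
    constructor
    · intro hxy
      rcases hA.shape _ hxy with he | ⟨i, j, he⟩
      · simp only at he
        subst he
        rcases x with i | j
        · exact Or.inr (Or.inl ⟨i, rfl, rfl, (hA.manSingle i).mp hxy⟩)
        · exact Or.inr (Or.inr ⟨j, rfl, rfl, (hA.womanSingle j).mp hxy⟩)
      · obtain ⟨rfl, rfl⟩ := Prod.ext_iff.mp he
        have := (hA.couple i j).mp hxy
        exact Or.inl ⟨i, j, rfl, rfl, ⟨i, j, rfl, rfl, this.1⟩, ⟨i, j, rfl, rfl, this.2⟩⟩
    · rintro (⟨i, j, rfl, rfl, ⟨i', j', hi, hj, h1⟩, ⟨i'', j'', hi', hj', h2⟩⟩ |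
        ⟨i, rfl, rfl, h⟩ | ⟨j, rfl, rfl, h⟩)
      · rw [← hi, ← hj] at h1
        rw [← hi', ← hj'] at h2
        exact (hA.couple i j).mpr ⟨h1, h2⟩
      · exact (hA.manSingle i).mpr h
      · exact (hA.womanSingle j).mpr h
  | manpropose x y => rw [fires_manpropose, hacc]; rfl
  | womanpropose x y => rw [fires_womanpropose, hacc]; rfl
  | mancost a b =>
    have hpart := partner_man_iff hA.isMarriages
    rw [fires_mancost]
    simp only [hacc', candidateAtoms]
    refine and_congr_right fun _ => ?_
    constructor
    · rintro ⟨i, rfl, rfl⟩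
      have hi := (hpart i _).mp rfl
      rcases shape_man hA.shape hi with he | ⟨j, he⟩
      · exact Or.inr ⟨i, rfl, by rw [manCost, he], by rw [he] at hi; exact hi⟩
      · exact Or.inl ⟨i, j, rfl, by rw [manCost, he], by rw [he] at hi; exact hA.man_acc hi,
          by rw [he] at hi; exact hi⟩
    · rintro (⟨i, j, rfl, rfl, -, h1⟩ | ⟨i, rfl, rfl, h1⟩)
      · exact ⟨i, rfl, by rw [manCost, (hpart i _).mpr h1]⟩
      · exact ⟨i, rfl, by rw [manCost, (hpart i _).mpr h1]⟩
  | womancost a b =>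
    have hpart := partner_woman_iff hA.isMarriages
    rw [fires_womancost]
    simp only [hacc', candidateAtoms]
    refine and_congr_right fun _ => ?_
    constructor
    · rintro ⟨j, rfl, rfl⟩
      have hj := (hpart j _).mp rfl
      rcases shape_woman hA.shape hj with he | ⟨i, he⟩
      · exact Or.inr ⟨j, rfl, by rw [womanCost, he], by rw [he] at hj; exact hj⟩
      · exact Or.inl ⟨j, i, rfl, by rw [womanCost, he], by rw [he] at hj; exact hA.woman_acc hj,
          by rw [he] at hj; exact hj⟩
    · rintro (⟨j, i, rfl, rfl, -, h1⟩ | ⟨j, rfl, rfl, h1⟩)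
      · exact ⟨j, rfl, by rw [womanCost, (hpart j _).mpr h1]⟩
      · exact ⟨j, rfl, by rw [womanCost, (hpart j _).mpr h1]⟩
  | manweight z =>
    rw [fires_manweight]
    refine and_congr_right fun hc => ?_
    rw [sumAgg_iff (g := manCost P κ A)]
    intro a b
    rw [hmc]
    rcases hc with rfl | rfl <;> simp
  | womanweight z =>
    rw [fires_womanweight]
    refine and_congr_right fun hc => ?_
    rw [sumAgg_iff (g := womanCost P κ A)]
    intro a b
    rw [hwc]
    rcases hc with rfl | rfl <;> simp
  | manregret z =>
    rw [fires_manregret]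
    refine and_congr_right fun hc => ?_
    rw [maxAgg_iff hn (g := manCost P κ A)]
    intro a b
    rw [hmc]
    simp [hc]
  | womanregret z =>
    rw [fires_womanregret]
    refine and_congr_right fun hc => ?_
    rw [maxAgg_iff hp (g := womanCost P κ A)]
    intro a b
    rw [hwc]
    simp [hc]
  | crit d v =>
    rw [fires_crit]
    refine and_congr_right fun _ => ?_
    by_cases hc : c = .singles
    · subst hc
      simp only [true_and, ne_eq, not_true_eq_false, false_and, or_false, CountAgg, critCost,
        hacc']
      exact eq_comm
    · rw [critCost_eq_combine P κ hc]
      have h1 : ∀ z, manValueAtom c z ∈ I ↔ z = groupValue c (manCost P κ A) := by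
        intro z
        cases c with
        | singles => exact absurd rfl hc
        | regret => simp [manValueAtom, hI (manregret z) trivial, candidateAtoms, groupValue]
        | _ => simp [manValueAtom, hI (manweight z) trivial, candidateAtoms, groupValue]
      have h2 : ∀ z, womanValueAtom c z ∈ I ↔ z = groupValue c (womanCost P κ A) := by
        intro z
        cases c with
        | singles => exact absurd rfl hc
        | regret => simp [womanValueAtom, hI (womanregret z) trivial, candidateAtoms, groupValue]
        | _ => simp [womanValueAtom, hI (womanweight z) trivial, candidateAtoms, groupValue]
      simp [hc, h1, h2]
  | _ => exact absurd ha (by simp [Unprimed])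

/-! ## The second candidate and saturation -/

/-- The primed predicate for the value for the men. -/
def manValueAtom' (c : Criterion) : ℕ → Atom n p :=
  match c with
  | .regret => manregret'
  | _ => manweight'

/-- The primed predicate for the value for the women. -/
def womanValueAtom' (c : Criterion) : ℕ → Atom n p :=
  match c with
  | .regret => womanregret'
  | _ => womanweight'

/-- The definite rules that compute the criterion value of the second candidate. -/
def ValueRule' (P : Instance n p) (κ : CostConvention) (c : Criterion)
    (r : Rule (Atom n p)) : Prop :=
  (c ≠ .singles ∧ CostRule' P κ r) ∨ ((c = .sexeq ∨ c = .weight) ∧ WeightRule' r) ∨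
    (c = .regret ∧ RegretRule' r) ∨ (c = .singles ∧ SinglesRule' r) ∨
    (c ≠ .singles ∧ ∃ x y, r =
      { head := {crit' c (combine c x y)}, pos := {manValueAtom' c x, womanValueAtom' c y} })

theorem mem_extProgram' {P : Instance n p} {κ : CostConvention} {c : Criterion}
    {r : Rule (Atom n p)} : r ∈ extProgram' P κ c ↔
      DisjRule' P r ∨ ConsistencyRule' r ∨ ValueRule' P κ c r := by
  cases c <;> simp [extProgram', ValueRule', combineRule_iff, manValueAtom', womanValueAtom',
    or_assoc]

theorem DisjRule'.body {P : Instance n p} {r : Rule (Atom n p)} (h : DisjRule' P r) :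
    r.neg = ∅ ∧ (∀ X, r.agg X) ∧ r.pos = ∅ := by
  cases h <;> simp

theorem DisjRule'.not_unprimed {P : Instance n p} {r : Rule (Atom n p)} (h : DisjRule' P r) :
    ∀ a ∈ r.head, ¬ Unprimed a := by
  cases h <;> simp only [Set.mem_insert_iff, Set.mem_singleton_iff, Set.mem_union,
    Set.mem_ofPred_eq] <;> intro a ha <;> grind [Unprimed]

theorem ConsistencyRule'.head_body {r : Rule (Atom n p)} (h : ConsistencyRule' r) :
    r.head = {sat} ∧ r.neg = ∅ ∧ (∀ X, r.agg X) ∧ ∀ b ∈ r.pos, ¬ Unprimed b := by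
  cases h <;> simp [Unprimed]

theorem ValueRule'.head_body {P : Instance n p} {κ : CostConvention} {c : Criterion}
    {r : Rule (Atom n p)} (h : ValueRule' P κ c r) : ∃ a, r.head = {a} ∧ ¬ Unprimed a ∧
      r.neg = ∅ ∧ (∀ X, r.agg X) ∧ ∀ b ∈ r.pos, ¬ Unprimed b := by
  rcases h with ⟨-, h⟩ | ⟨-, h⟩ | ⟨-, h⟩ | ⟨-, h⟩ | ⟨-, x, y, rfl⟩
  · cases h <;> exact ⟨_, rfl, id, rfl, fun _ => trivial, by simp [Unprimed]⟩
  · cases h <;> exact ⟨_, rfl, id, rfl, fun _ => trivial, by simp [Unprimed]⟩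
  · cases h <;> exact ⟨_, rfl, id, rfl, fun _ => trivial, by simp [Unprimed]⟩
  · cases h <;> exact ⟨_, rfl, id, rfl, fun _ => trivial, by simp [Unprimed]⟩
  · cases c <;> exact ⟨_, rfl, id, rfl, fun _ => trivial,
      by simp [Unprimed, manValueAtom', womanValueAtom']⟩

/-- Apart from the comparison rule and the constraint, a rule of group 3 is either triggered by
`sat` or a fact, so it is harmless for an interpretation without `sat` that contains the facts. -/
theorem SatRule.cases_head {c : Criterion} {r : Rule (Atom n p)} (h : SatRule c r) :
    (∃ x y, x ≤ y ∧ r = { head := {sat}, pos := {crit c x, crit' c y} }) ∨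
    r = { head := ∅, pos := ∅, neg := {sat} } ∨
    ∃ a, r.head = {a} ∧ ¬ Unprimed a ∧ r.neg = ∅ ∧ (∀ X, r.agg X) ∧
      (∀ b ∈ r.pos, ¬ Unprimed b) ∧
      (sat ∈ r.pos ∨ (∃ k, a = manargcost₁' k) ∨ (∃ k, a = manargcost₂' k) ∨
        (∃ k, a = womanargcost₁' k) ∨ (∃ k, a = womanargcost₂' k) ∨ (∃ x, a = Atom.man x) ∨
        ∃ x, a = Atom.woman x) := by
  cases h with
  | compare x y h => exact Or.inl ⟨x, y, h, rfl⟩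
  | notSat => exact Or.inr (Or.inl rfl)
  | _ => exact Or.inr (Or.inr ⟨_, rfl, id, rfl, fun _ => trivial, by simp [Unprimed], by simp⟩)

/-- The atoms that are derivable from `sat`. -/
def Saturated (P : Instance n p) (κ : CostConvention) (c : Criterion) : Atom n p → Prop :=
  Consequence (extProgram' P κ c ∪ {r | SatRule c r}) {sat}

/-! ### The definite closure of `sat` -/

section Saturated

variable {P : Instance n p} {κ : CostConvention} {c : Criterion}

theorem saturated_sat : Saturated P κ c sat := Consequence.base rfl

theorem saturated_of_satRule {r : Rule (Atom n p)} (h : SatRule c r) {a : Atom n p}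
    (hhead : r.head = {a}) (hneg : r.neg = ∅) (hagg : ∀ X, r.agg X)
    (hpos : ∀ b ∈ r.pos, Saturated P κ c b) : Saturated P κ c a :=
  Consequence.step (Or.inr h) hhead hneg hagg hpos

theorem saturated_man (i : Fin n) : Saturated P κ c (man (m i)) :=
  saturated_of_satRule (SatRule.man i) rfl rfl (fun _ => trivial) (by simp)

theorem saturated_woman (j : Fin p) : Saturated P κ c (woman (w j)) :=
  saturated_of_satRule (SatRule.woman j) rfl rfl (fun _ => trivial) (by simp)

theorem saturated_couple (i : Fin n) (j : Fin p) :
    Saturated P κ c (accept' (m i) (w j)) ∧ Saturated P κ c (naccept' (m i) (w j)) ∧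
    Saturated P κ c (manpropose' (m i) (w j)) ∧ Saturated P κ c (nmanpropose' (m i) (w j)) ∧
    Saturated P κ c (womanpropose' (m i) (w j)) ∧
    Saturated P κ c (nwomanpropose' (m i) (w j)) := by
  have h : ∀ b ∈ ({sat, man (m i), woman (w j)} : Set (Atom n p)), Saturated P κ c b := by
    rintro b (rfl | rfl | rfl)
    exacts [saturated_sat, saturated_man i, saturated_woman j]
  exact ⟨saturated_of_satRule (SatRule.accept _ _) rfl rfl (fun _ => trivial) h,
    saturated_of_satRule (SatRule.naccept _ _) rfl rfl (fun _ => trivial) h,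
    saturated_of_satRule (SatRule.manpropose _ _) rfl rfl (fun _ => trivial) h,
    saturated_of_satRule (SatRule.nmanpropose _ _) rfl rfl (fun _ => trivial) h,
    saturated_of_satRule (SatRule.womanpropose _ _) rfl rfl (fun _ => trivial) h,
    saturated_of_satRule (SatRule.nwomanpropose _ _) rfl rfl (fun _ => trivial) h⟩

theorem saturated_single (x : Person n p) :
    Saturated P κ c (accept' x x) ∧ Saturated P κ c (naccept' x x) := by
  rcases x with i | j
  · have h : ∀ b ∈ ({sat, man (m i)} : Set (Atom n p)), Saturated P κ c b := by
      rintro b (rfl | rfl)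
      exacts [saturated_sat, saturated_man i]
    exact ⟨saturated_of_satRule (SatRule.acceptMan _) rfl rfl (fun _ => trivial) h,
      saturated_of_satRule (SatRule.nacceptMan _) rfl rfl (fun _ => trivial) h⟩
  · have h : ∀ b ∈ ({sat, woman (w j)} : Set (Atom n p)), Saturated P κ c b := by
      rintro b (rfl | rfl)
      exacts [saturated_sat, saturated_woman j]
    exact ⟨saturated_of_satRule (SatRule.acceptWoman _) rfl rfl (fun _ => trivial) h,
      saturated_of_satRule (SatRule.nacceptWoman _) rfl rfl (fun _ => trivial) h⟩

theorem saturated_of_man_acc {i : Fin n} {x : Person n p} (h : P.Acc (m i) x) :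
    Saturated P κ c (accept' (m i) x) ∧ Saturated P κ c (naccept' (m i) x) := by
  rcases h.of_man with rfl | ⟨j, rfl⟩
  · exact saturated_single _
  · exact ⟨(saturated_couple i j).1, (saturated_couple i j).2.1⟩

theorem saturated_of_woman_acc {j : Fin p} {x : Person n p} (h : P.Acc (w j) x) :
    Saturated P κ c (accept' x (w j)) ∧ Saturated P κ c (naccept' x (w j)) := by
  rcases h.of_woman with rfl | ⟨i, rfl⟩
  · exact saturated_single _
  · exact ⟨(saturated_couple i j).1, (saturated_couple i j).2.1⟩

/-- This is what saturation is for: once `sat` holds, all alternatives of every disjunction hold at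
once. An interpretation containing the closure therefore has any choice of alternatives as a subset.
-/
theorem DisjRule'.saturated_head {r : Rule (Atom n p)} (h : DisjRule' P r) :
    ∀ a ∈ r.head, Saturated P κ c a := by
  cases h with
  | accept₁ i j | accept₂ i j | accept₃ i j =>
    have := saturated_couple (P := P) (κ := κ) (c := c) i j
    simp [this]
  | manSingle₁ i =>
    rintro a (⟨k, -, rfl⟩ | rfl)
    exacts [(saturated_couple i k).1, (saturated_single _).1]
  | womanSingle₁ j =>
    rintro a (⟨k, -, rfl⟩ | rfl)
    exacts [(saturated_couple k j).1, (saturated_single _).1]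
  | manSingle₂ i j h =>
    rintro a (rfl | rfl)
    exacts [(saturated_single _).2, (saturated_couple i j).2.1]
  | womanSingle₂ i j h =>
    rintro a (rfl | rfl)
    exacts [(saturated_single _).2, (saturated_couple i j).2.1]
  | manpropose₁ i j h x hx hne =>
    rintro a (rfl | rfl)
    exacts [(saturated_couple i j).2.2.2.1, (saturated_of_man_acc hx.1).2]
  | womanpropose₁ i j h x hx hne =>
    rintro a (rfl | rfl)
    exacts [(saturated_couple i j).2.2.2.2.2, (saturated_of_woman_acc hx.1).2]
  | manpropose₂ i j h =>
    rintro a (⟨x, hx, -, rfl⟩ | rfl)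
    exacts [(saturated_of_man_acc hx.1).1, (saturated_couple i j).2.2.1]
  | womanpropose₂ i j h =>
    rintro a (⟨x, hx, -, rfl⟩ | rfl)
    exacts [(saturated_of_woman_acc hx.1).1, (saturated_couple i j).2.2.2.2.1]
  | manpropose₃ i j h =>
    rintro a rfl
    exact (saturated_couple i j).2.2.2.1
  | womanpropose₃ i j h =>
    rintro a rfl
    exact (saturated_couple i j).2.2.2.2.2

/-- Saturating must not disturb the first candidate: no rule of groups 2 and 3 has an unprimed head.
-/
theorem Saturated.not_unprimed {a : Atom n p} (h : Saturated P κ c a) : ¬ Unprimed a := by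
  cases h with
  | base h => obtain rfl := Set.mem_singleton_iff.mp h; exact id
  | step hr hhead hneg hagg hpos =>
    have hmem : a ∈ ({a} : Set (Atom n p)) := rfl
    rcases hr with hr | hr
    · rcases mem_extProgram'.mp hr with h | h | h
      · exact h.not_unprimed a (hhead ▸ hmem)
      · rw [h.head_body.1] at hhead
        obtain rfl := Set.singleton_injective hhead
        exact id
      · obtain ⟨b, hb, hbu, -⟩ := h.head_body
        rw [hb] at hhead
        obtain rfl := Set.singleton_injective hhead
        exact hbu
    · rcases SatRule.cases_head hr with ⟨x, y, -, rfl⟩ | rfl | ⟨b, hb, hbu, -⟩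
      · obtain rfl := Set.singleton_injective hhead
        exact id
      · rw [← hhead] at hmem
        exact absurd hmem (Set.notMem_empty a)
      · rw [hb] at hhead
        obtain rfl := Set.singleton_injective hhead
        exact hbu

end Saturated

/-! ### A stable set as a `sat`-free interpretation of group 2 -/

/-- The unprimed atoms, the facts, and the primed atoms other than `sat` that are true for a
stable set of marriages `A` as the second candidate. -/
def comparisonAtoms (P : Instance n p) (κ : CostConvention)
    (A : Set (Person n p × Person n p)) : Atom n p → Prop
  | accept' x y => (x, y) ∈ A
  | naccept' x y => (x, y) ∉ A
  | manpropose' x y => ManProposes P A x y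
  | nmanpropose' x y => ¬ ManProposes P A x y
  | womanpropose' x y => WomanProposes P A x y
  | nwomanpropose' x y => ¬ WomanProposes P A x y
  | mancost' a z => ∃ i : Fin n, finIdx i = a ∧ z = manCost P κ A i
  | womancost' a z => ∃ j : Fin p, finIdx j = a ∧ z = womanCost P κ A j
  | mansum' a z => z = tailSum finIdx (manCost P κ A) a
  | womansum' a z => z = tailSum finIdx (womanCost P κ A) a
  | manweight' z => z = ∑ i, manCost P κ A i
  | womanweight' z => z = ∑ j, womanCost P κ A j
  | manmax' a z => z = tailSup finIdx (manCost P κ A) a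
  | womanmax' a z => z = tailSup finIdx (womanCost P κ A) a
  | manregret' z => z = Finset.univ.sup (manCost P κ A)
  | womanregret' z => z = Finset.univ.sup (womanCost P κ A)
  | single' a z => ∃ x : Person n p, personIdx x = a ∧ z = singleCost A x
  | singlesum' a z => z = tailSum personIdx (singleCost A) a
  | crit' d v => v = critCost P κ d A
  | sat => False
  | _ => True

section Comparison

variable {P : Instance n p} {κ : CostConvention} {c : Criterion}
  {A : Set (Person n p × Person n p)}

/-- Unprimed atoms count as true so that intersecting an answer set with `comparisonAtoms` leaves
its first candidate intact. -/
theorem comparisonAtoms_of_unprimed {a : Atom n p} (h : Unprimed a) :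
    comparisonAtoms P κ A a := by
  cases a <;> trivial

/-- Each disjunction is a clause of one of the equivalences in `IsCandidate` or in the definitions
of proposing, so excluded middle selects a true head atom. -/
theorem DisjRule'.comparison (hA : IsCandidate P A) {r : Rule (Atom n p)} (h : DisjRule' P r) :
    ∃ a ∈ r.head, comparisonAtoms P κ A a := by
  cases h with
  | accept₁ i j =>
    by_cases hij : (m i, w j) ∈ A
    · exact ⟨_, Or.inr rfl, ((hA.couple i j).mp hij).1⟩
    · exact ⟨_, Or.inl rfl, hij⟩
  | accept₂ i j =>
    by_cases hij : (m i, w j) ∈ A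
    · exact ⟨_, Or.inr rfl, ((hA.couple i j).mp hij).2⟩
    · exact ⟨_, Or.inl rfl, hij⟩
  | accept₃ i j =>
    by_cases h1 : ManProposes P A (m i) (w j)
    · by_cases h2 : WomanProposes P A (m i) (w j)
      · exact ⟨_, Or.inl rfl, (hA.couple i j).mpr ⟨h1, h2⟩⟩
      · exact ⟨_, Or.inr (Or.inr rfl), h2⟩
    · exact ⟨_, Or.inr (Or.inl rfl), h1⟩
  | manSingle₁ i =>
    by_cases hi : (m i, m i) ∈ A
    · exact ⟨_, Or.inr rfl, hi⟩
    · rw [hA.manSingle] at hi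
      push Not at hi
      obtain ⟨k, hk, hkA⟩ := hi
      exact ⟨_, Or.inl ⟨k, hk, rfl⟩, hkA⟩
  | womanSingle₁ j =>
    by_cases hj : (w j, w j) ∈ A
    · exact ⟨_, Or.inr rfl, hj⟩
    · rw [hA.womanSingle] at hj
      push Not at hj
      obtain ⟨k, hk, hkA⟩ := hj
      exact ⟨_, Or.inl ⟨k, hk, rfl⟩, hkA⟩
  | manSingle₂ i j h =>
    by_cases hi : (m i, m i) ∈ A
    · exact ⟨_, Or.inr rfl, (hA.manSingle i).mp hi j h⟩
    · exact ⟨_, Or.inl rfl, hi⟩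
  | womanSingle₂ i j h =>
    by_cases hj : (w j, w j) ∈ A
    · exact ⟨_, Or.inr rfl, (hA.womanSingle j).mp hj i h⟩
    · exact ⟨_, Or.inl rfl, hj⟩
  | manpropose₁ i j h x hx hne =>
    by_cases hxA : (m i, x) ∈ A
    · exact ⟨_, Or.inl rfl, fun hp => hp.2 x hx hne hxA⟩
    · exact ⟨_, Or.inr rfl, hxA⟩
  | womanpropose₁ i j h x hx hne =>
    by_cases hxA : (x, w j) ∈ A
    · exact ⟨_, Or.inl rfl, fun hp => hp.2 x hx hne hxA⟩
    · exact ⟨_, Or.inr rfl, hxA⟩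
  | manpropose₂ i j h =>
    by_cases hx : ∃ x, P.Le (m i) x (w j) ∧ x ≠ w j ∧ (m i, x) ∈ A
    · obtain ⟨x, hx, hne, hxA⟩ := hx
      exact ⟨_, Or.inl ⟨x, hx, hne, rfl⟩, hxA⟩
    · exact ⟨_, Or.inr rfl, h, fun z hz hne hzA => hx ⟨z, hz, hne, hzA⟩⟩
  | womanpropose₂ i j h =>
    by_cases hx : ∃ x, P.Le (w j) x (m i) ∧ x ≠ m i ∧ (x, w j) ∈ A
    · obtain ⟨x, hx, hne, hxA⟩ := hx
      exact ⟨_, Or.inl ⟨x, hx, hne, rfl⟩, hxA⟩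
    · exact ⟨_, Or.inr rfl, h, fun z hz hne hzA => hx ⟨z, hz, hne, hzA⟩⟩
  | manpropose₃ i j h => exact ⟨_, rfl, fun hp => h hp.1⟩
  | womanpropose₃ i j h => exact ⟨_, rfl, fun hp => h hp.1⟩

theorem ConsistencyRule'.comparison {r : Rule (Atom n p)} (h : ConsistencyRule' r)
    (hpos : ∀ b ∈ r.pos, comparisonAtoms P κ A b) : False := by
  cases h <;> exact (hpos _ (Or.inr rfl)) (hpos _ (Or.inl rfl))

theorem CostRule'.comparison (hA : IsMarriages A) {r : Rule (Atom n p)} (h : CostRule' P κ r)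
    (hpos : ∀ b ∈ r.pos, comparisonAtoms P κ A b) : ∀ a ∈ r.head, comparisonAtoms P κ A a := by
  cases h with
  | mancost i j h =>
    rintro _ rfl
    exact ⟨i, rfl, by rw [manCost, (partner_man_iff hA i _).mpr (hpos _ rfl)]⟩
  | mancostSingle i =>
    rintro _ rfl
    exact ⟨i, rfl, by rw [manCost, (partner_man_iff hA i _).mpr (hpos _ rfl)]⟩
  | womancost i j h =>
    rintro _ rfl
    exact ⟨j, rfl, by rw [womanCost, (partner_woman_iff hA j _).mpr (hpos _ rfl)]⟩
  | womancostSingle j =>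
    rintro _ rfl
    exact ⟨j, rfl, by rw [womanCost, (partner_woman_iff hA j _).mpr (hpos _ rfl)]⟩

theorem WeightRule'.comparison {r : Rule (Atom n p)} (h : WeightRule' r)
    (hpos : ∀ b ∈ r.pos, comparisonAtoms P κ A b) : ∀ a ∈ r.head, comparisonAtoms P κ A a := by
  cases h with
  | mansum₁ x =>
    rintro _ rfl
    obtain ⟨i, hi, rfl⟩ := hpos _ rfl
    exact (tailSum_last finIdx_injective _ finIdx_le hi).symm
  | womansum₁ x =>
    rintro _ rfl
    obtain ⟨i, hi, rfl⟩ := hpos _ rfl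
    exact (tailSum_last finIdx_injective _ finIdx_le hi).symm
  | mansum₂ I J x y z hz hs =>
    rintro _ rfl
    -- The ground rules range over all indices, but the cost atom in the body guarantees that `J` is
    -- the number of an actual man; only there does the recursion have to hold.
    obtain ⟨i, rfl, rfl⟩ := hpos _ (Or.inr rfl)
    have hx : x = _ := hpos _ (Or.inl rfl)
    subst hz hs hx
    exact (tailSum_idx finIdx_injective _ i).symm
  | womansum₂ I J x y z hz hs =>
    rintro _ rfl
    obtain ⟨i, rfl, rfl⟩ := hpos _ (Or.inr rfl)
    have hx : x = _ := hpos _ (Or.inl rfl)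
    subst hz hs hx
    exact (tailSum_idx finIdx_injective _ i).symm
  | manweight z =>
    rintro _ rfl
    have hz : z = _ := hpos _ rfl
    exact hz.trans (tailSum_one one_le_finIdx _)
  | womanweight z =>
    rintro _ rfl
    have hz : z = _ := hpos _ rfl
    exact hz.trans (tailSum_one one_le_finIdx _)

theorem RegretRule'.comparison {r : Rule (Atom n p)} (h : RegretRule' r)
    (hpos : ∀ b ∈ r.pos, comparisonAtoms P κ A b) : ∀ a ∈ r.head, comparisonAtoms P κ A a := by
  cases h with
  | manmax₁ x =>
    rintro _ rfl
    obtain ⟨i, hi, rfl⟩ := hpos _ rfl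
    exact (tailSup_last finIdx_injective _ finIdx_le hi).symm
  | womanmax₁ x =>
    rintro _ rfl
    obtain ⟨i, hi, rfl⟩ := hpos _ rfl
    exact (tailSup_last finIdx_injective _ finIdx_le hi).symm
  | manmax₂ I J x y h hs =>
    rintro _ rfl
    obtain ⟨i, rfl, rfl⟩ := hpos _ (Or.inr rfl)
    have hx : x = _ := hpos _ (Or.inl rfl)
    subst hs hx
    exact (max_eq_left h).symm.trans (tailSup_idx finIdx_injective _ i).symm
  | womanmax₂ I J x y h hs =>
    rintro _ rfl
    obtain ⟨i, rfl, rfl⟩ := hpos _ (Or.inr rfl)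
    have hx : x = _ := hpos _ (Or.inl rfl)
    subst hs hx
    exact (max_eq_left h).symm.trans (tailSup_idx finIdx_injective _ i).symm
  | manmax₃ I J x y h hs =>
    rintro _ rfl
    obtain ⟨i, rfl, rfl⟩ := hpos _ (Or.inr rfl)
    have hx : x = _ := hpos _ (Or.inl rfl)
    subst hs hx
    exact (max_eq_right h.le).symm.trans (tailSup_idx finIdx_injective _ i).symm
  | womanmax₃ I J x y h hs =>
    rintro _ rfl
    obtain ⟨i, rfl, rfl⟩ := hpos _ (Or.inr rfl)
    have hx : x = _ := hpos _ (Or.inl rfl)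
    subst hs hx
    exact (max_eq_right h.le).symm.trans (tailSup_idx finIdx_injective _ i).symm
  | manregret z =>
    rintro _ rfl
    have hz : z = _ := hpos _ rfl
    exact hz.trans (tailSup_one one_le_finIdx _)
  | womanregret z =>
    rintro _ rfl
    have hz : z = _ := hpos _ rfl
    exact hz.trans (tailSup_one one_le_finIdx _)

theorem SinglesRule'.comparison {r : Rule (Atom n p)} (h : SinglesRule' r)
    (hpos : ∀ b ∈ r.pos, comparisonAtoms P κ A b) : ∀ a ∈ r.head, comparisonAtoms P κ A a := by
  cases h with
  | man₁ i =>
    rintro _ rfl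
    have h : _ ∈ A := hpos _ rfl
    exact ⟨m i, rfl, (if_pos h).symm⟩
  | man₀ i =>
    rintro _ rfl
    have h : _ ∉ A := hpos _ rfl
    exact ⟨m i, rfl, (if_neg h).symm⟩
  | woman₁ j =>
    rintro _ rfl
    have h : _ ∈ A := hpos _ rfl
    exact ⟨w j, rfl, (if_pos h).symm⟩
  | woman₀ j =>
    rintro _ rfl
    have h : _ ∉ A := hpos _ rfl
    exact ⟨w j, rfl, (if_neg h).symm⟩
  | singlesum₁ x =>
    rintro _ rfl
    obtain ⟨i, hi, rfl⟩ := hpos _ rfl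
    exact (tailSum_last personIdx_injective _ personIdx_le hi).symm
  | singlesum₂ I J x y z hz hs =>
    rintro _ rfl
    obtain ⟨i, rfl, rfl⟩ := hpos _ (Or.inr rfl)
    have hx : x = _ := hpos _ (Or.inl rfl)
    subst hz hs hx
    exact (tailSum_idx personIdx_injective _ i).symm
  | singles z =>
    rintro _ rfl
    have hz : z = _ := hpos _ rfl
    exact (hz.trans (tailSum_one one_le_personIdx _)).trans (critCost_singles P κ A).symm

theorem ValueRule'.comparison (hA : IsMarriages A) {r : Rule (Atom n p)}
    (h : ValueRule' P κ c r) (hpos : ∀ b ∈ r.pos, comparisonAtoms P κ A b) :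
    ∀ a ∈ r.head, comparisonAtoms P κ A a := by
  rcases h with ⟨-, h⟩ | ⟨-, h⟩ | ⟨-, h⟩ | ⟨-, h⟩ | ⟨hc, x, y, rfl⟩
  · exact h.comparison hA hpos
  · exact h.comparison hpos
  · exact h.comparison hpos
  · exact h.comparison hpos
  · rintro _ rfl
    have hx := hpos _ (Or.inl rfl)
    have hy := hpos _ (Or.inr rfl)
    -- `comparisonAtoms` does not restrict the criterion of a `crit'` atom, so only the value needs
    -- checking.
    show combine c x y = critCost P κ c A
    rw [critCost_eq_combine P κ hc]
    cases c with
    | singles => exact absurd rfl hc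
    | _ =>
      obtain rfl : x = _ := hx
      obtain rfl : y = _ := hy
      rfl

end Comparison

/-! ### Reading a stable set off a `sat`-free model of group 2 -/

/-- The set of marriages described by the `accept'` atoms of an interpretation. -/
def acceptedPairs' (J : Set (Atom n p)) : Set (Person n p × Person n p) :=
  {q | accept' q.1 q.2 ∈ J ∧ (q.1 = q.2 ∨ ∃ i j, q = (m i, w j))}

section Model

variable {P : Instance n p} {κ : CostConvention} {c : Criterion} {J : Set (Atom n p)}

theorem mem_couple' {i : Fin n} {j : Fin p} :
    (m i, w j) ∈ acceptedPairs' J ↔ accept' (m i) (w j) ∈ J := by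
  simp [acceptedPairs']

theorem mem_single' {x : Person n p} : (x, x) ∈ acceptedPairs' J ↔ accept' x x ∈ J := by
  simp [acceptedPairs']

theorem mem_of_man_acc' {i : Fin n} {x : Person n p} (h : P.Acc (m i) x) :
    (m i, x) ∈ acceptedPairs' J ↔ accept' (m i) x ∈ J := by
  rcases h.of_man with rfl | ⟨j, rfl⟩
  exacts [mem_single', mem_couple']

theorem mem_of_woman_acc' {j : Fin p} {x : Person n p} (h : P.Acc (w j) x) :
    (x, w j) ∈ acceptedPairs' J ↔ accept' x (w j) ∈ J := by
  rcases h.of_woman with rfl | ⟨j, rfl⟩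
  exacts [mem_single', mem_couple']

variable (hJ : ∀ r ∈ extProgram' P κ c, r.pos ⊆ J → ∃ a ∈ r.head, a ∈ J)

include hJ

theorem exists_mem_of_disjRule' {r : Rule (Atom n p)} (h : DisjRule' P r) :
    ∃ a ∈ r.head, a ∈ J :=
  hJ r (mem_extProgram'.mpr (Or.inl h)) (by simp [h.body.2.2])

theorem not_body_of_consistencyRule' (hsat : sat ∉ J) {r : Rule (Atom n p)}
    (h : ConsistencyRule' r) : ¬ r.pos ⊆ J := by
  intro hpos
  obtain ⟨a, ha, haJ⟩ := hJ r (mem_extProgram'.mpr (Or.inr (Or.inl h))) hpos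
  rw [h.head_body.1] at ha
  exact hsat (ha ▸ haJ)

theorem mem_of_valueRule' {r : Rule (Atom n p)} (h : ValueRule' P κ c r) {a : Atom n p}
    (ha : r.head = {a}) (hpos : r.pos ⊆ J) : a ∈ J := by
  obtain ⟨b, hb, hbJ⟩ := hJ r (mem_extProgram'.mpr (Or.inr (Or.inr h))) hpos
  rw [ha] at hb
  exact hb ▸ hbJ

theorem not_naccept_couple' (hsat : sat ∉ J) {i : Fin n} {j : Fin p}
    (h : accept' (m i) (w j) ∈ J) : naccept' (m i) (w j) ∉ J := fun h' =>
  not_body_of_consistencyRule' hJ hsat (.accept i j) (by rintro _ (rfl | rfl) <;> assumption)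

theorem not_naccept_single' (hsat : sat ∉ J) {x : Person n p}
    (h : accept' x x ∈ J) : naccept' x x ∉ J := fun h' => by
  rcases x with i | j
  · exact not_body_of_consistencyRule' hJ hsat (.manSingle i)
      (by rintro _ (rfl | rfl) <;> assumption)
  · exact not_body_of_consistencyRule' hJ hsat (.womanSingle j)
      (by rintro _ (rfl | rfl) <;> assumption)

/-- Without `sat` an atom and its `n`-atom never hold together, so the clauses can be resolved
classically and give back the equivalence that they encode. Minimality of `J` plays no role. -/
theorem manpropose'_iff (hsat : sat ∉ J) (i : Fin n) (j : Fin p) :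
    manpropose' (m i) (w j) ∈ J ↔ ManProposes P (acceptedPairs' J) (m i) (w j) := by
  constructor
  · intro h
    have hn : nmanpropose' (m i) (w j) ∉ J := fun h' =>
      not_body_of_consistencyRule' hJ hsat (.manpropose i j)
        (by rintro _ (rfl | rfl) <;> assumption)
    have ha : P.Acc (m i) (w j) := by
      by_contra ha
      obtain ⟨_, rfl, h'⟩ := exists_mem_of_disjRule' hJ (.manpropose₃ i j ha)
      exact hn h'
    refine ⟨ha, fun z hz hne hzJ => ?_⟩
    rw [mem_of_man_acc' hz.1] at hzJ
    obtain ⟨_, rfl | rfl, h'⟩ := exists_mem_of_disjRule' hJ (.manpropose₁ i j ha z hz hne)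
    · exact hn h'
    · rcases hz.1.of_man with rfl | ⟨k, rfl⟩
      · exact not_naccept_single' hJ hsat hzJ h'
      · exact not_naccept_couple' hJ hsat hzJ h'
  · rintro ⟨ha, h⟩
    obtain ⟨_, ⟨x, hx, hne, rfl⟩ | rfl, h'⟩ := exists_mem_of_disjRule' hJ (.manpropose₂ i j ha)
    · exact absurd ((mem_of_man_acc' hx.1).mpr h') (h x hx hne)
    · exact h'

theorem womanpropose'_iff (hsat : sat ∉ J) (i : Fin n) (j : Fin p) :
    womanpropose' (m i) (w j) ∈ J ↔ WomanProposes P (acceptedPairs' J) (m i) (w j) := by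
  constructor
  · intro h
    have hn : nwomanpropose' (m i) (w j) ∉ J := fun h' =>
      not_body_of_consistencyRule' hJ hsat (.womanpropose i j)
        (by rintro _ (rfl | rfl) <;> assumption)
    have ha : P.Acc (w j) (m i) := by
      by_contra ha
      obtain ⟨_, rfl, h'⟩ := exists_mem_of_disjRule' hJ (.womanpropose₃ i j ha)
      exact hn h'
    refine ⟨ha, fun z hz hne hzJ => ?_⟩
    rw [mem_of_woman_acc' hz.1] at hzJ
    obtain ⟨_, rfl | rfl, h'⟩ := exists_mem_of_disjRule' hJ (.womanpropose₁ i j ha z hz hne)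
    · exact hn h'
    · rcases hz.1.of_woman with rfl | ⟨k, rfl⟩
      · exact not_naccept_single' hJ hsat hzJ h'
      · exact not_naccept_couple' hJ hsat hzJ h'
  · rintro ⟨ha, h⟩
    obtain ⟨_, ⟨x, hx, hne, rfl⟩ | rfl, h'⟩ := exists_mem_of_disjRule' hJ (.womanpropose₂ i j ha)
    · exact absurd ((mem_of_woman_acc' hx.1).mpr h') (h x hx hne)
    · exact h'

/-- Resolution of the clauses again. The shape condition is built into `acceptedPairs'`, since an
arbitrary model may contain ill-typed `accept'` atoms. -/
theorem isCandidate_acceptedPairs' (hsat : sat ∉ J) : IsCandidate P (acceptedPairs' J) where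
  shape q hq := hq.2
  couple i j := by
    rw [← manpropose'_iff hJ hsat, ← womanpropose'_iff hJ hsat, mem_couple']
    constructor
    · intro h
      have hn := not_naccept_couple' hJ hsat h
      constructor
      · obtain ⟨_, rfl | rfl, h'⟩ := exists_mem_of_disjRule' hJ (.accept₁ i j)
        exacts [absurd h' hn, h']
      · obtain ⟨_, rfl | rfl, h'⟩ := exists_mem_of_disjRule' hJ (.accept₂ i j)
        exacts [absurd h' hn, h']
    · rintro ⟨h1, h2⟩
      obtain ⟨_, rfl | rfl | rfl, h'⟩ := exists_mem_of_disjRule' hJ (.accept₃ i j)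
      · exact h'
      · exact absurd (by rintro _ (rfl | rfl) <;> assumption)
          (not_body_of_consistencyRule' hJ hsat (.manpropose i j))
      · exact absurd (by rintro _ (rfl | rfl) <;> assumption)
          (not_body_of_consistencyRule' hJ hsat (.womanpropose i j))
  manSingle i := by
    rw [mem_single']
    constructor
    · intro h k hk hkJ
      rw [mem_couple'] at hkJ
      obtain ⟨_, rfl | rfl, h'⟩ := exists_mem_of_disjRule' hJ (.manSingle₂ i k hk)
      · exact not_naccept_single' hJ hsat h h'
      · exact not_naccept_couple' hJ hsat hkJ h'
    · intro h
      obtain ⟨_, ⟨k, hk, rfl⟩ | rfl, h'⟩ := exists_mem_of_disjRule' hJ (.manSingle₁ i)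
      · exact absurd (mem_couple'.mpr h') (h k hk)
      · exact h'
  womanSingle j := by
    rw [mem_single']
    constructor
    · intro h k hk hkJ
      rw [mem_couple'] at hkJ
      obtain ⟨_, rfl | rfl, h'⟩ := exists_mem_of_disjRule' hJ (.womanSingle₂ k j hk)
      · exact not_naccept_single' hJ hsat h h'
      · exact not_naccept_couple' hJ hsat hkJ h'
    · intro h
      obtain ⟨_, ⟨k, hk, rfl⟩ | rfl, h'⟩ := exists_mem_of_disjRule' hJ (.womanSingle₁ j)
      · exact absurd (mem_couple'.mpr h') (h k hk)
      · exact h'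

theorem mancost'_mem (hsat : sat ∉ J) (hc : c ≠ .singles) (i : Fin n) :
    mancost' (finIdx i) (manCost P κ (acceptedPairs' J) i) ∈ J := by
  have hA := isCandidate_acceptedPairs' hJ hsat
  have hi := (partner_man_iff hA.isMarriages i _).mp rfl
  rcases shape_man hA.shape hi with he | ⟨j, he⟩
  · refine mem_of_valueRule' hJ (Or.inl ⟨hc, .mancostSingle i⟩) (by rw [manCost, he]; rfl) ?_
    rw [he] at hi
    simpa using mem_single'.mp hi
  · refine mem_of_valueRule' hJ (Or.inl ⟨hc, .mancost i j ?_⟩) (by rw [manCost, he]; rfl) ?_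
    · rw [he] at hi; exact hA.man_acc hi
    · rw [he] at hi
      simpa using mem_couple'.mp hi

theorem womancost'_mem (hsat : sat ∉ J) (hc : c ≠ .singles) (j : Fin p) :
    womancost' (finIdx j) (womanCost P κ (acceptedPairs' J) j) ∈ J := by
  have hA := isCandidate_acceptedPairs' hJ hsat
  have hj := (partner_woman_iff hA.isMarriages j _).mp rfl
  rcases shape_woman hA.shape hj with he | ⟨i, he⟩
  · refine mem_of_valueRule' hJ (Or.inl ⟨hc, .womancostSingle j⟩) (by rw [womanCost, he]; rfl) ?_
    rw [he] at hj
    simpa using mem_single'.mp hj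
  · refine mem_of_valueRule' hJ (Or.inl ⟨hc, .womancost i j ?_⟩) (by rw [womanCost, he]; rfl) ?_
    · rw [he] at hj; exact hA.woman_acc hj
    · rw [he] at hj
      simpa using mem_couple'.mp hj

theorem manValueAtom'_mem (hn : 0 < n) (hsat : sat ∉ J) (hc : c ≠ .singles) :
    manValueAtom' c (groupValue c (manCost P κ (acceptedPairs' J))) ∈ J := by
  have hcost := mancost'_mem hJ hsat hc
  have hsum : c = .sexeq ∨ c = .weight →
      manweight' (∑ i, manCost P κ (acceptedPairs' J) i) ∈ J := by
    intro hc'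
    refine mem_of_valueRule' hJ (Or.inr (Or.inl ⟨hc', .manweight _⟩)) rfl ?_
    rw [← tailSum_one one_le_finIdx, Set.singleton_subset_iff]
    refine derive_tail (s := fun a z => mansum' a z ∈ J) (c := fun a z => mancost' a z ∈ J)
      (op := (· + ·)) hn (fun a => exists_finIdx)
      (fun x => tailSum_last finIdx_injective _ finIdx_le) (tailSum_idx finIdx_injective _)
      hcost (fun x hx => ?_) (fun K x y hx hy => ?_)
    · exact mem_of_valueRule' hJ (Or.inr (Or.inl ⟨hc', .mansum₁ x⟩)) rfl (by simpa using hx)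
    · exact mem_of_valueRule' hJ (Or.inr (Or.inl ⟨hc', .mansum₂ (K + 1) K x y _ rfl rfl⟩)) rfl
        (by rintro _ (rfl | rfl) <;> assumption)
  cases c with
  | singles => exact absurd rfl hc
  | sexeq => exact hsum (Or.inl rfl)
  | weight => exact hsum (Or.inr rfl)
  | regret =>
    refine mem_of_valueRule' hJ (Or.inr (Or.inr (Or.inl ⟨rfl, .manregret _⟩))) rfl ?_
    rw [groupValue, ← tailSup_one one_le_finIdx, Set.singleton_subset_iff]
    refine derive_tail (s := fun a z => manmax' a z ∈ J) (c := fun a z => mancost' a z ∈ J)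
      (op := max) hn (fun a => exists_finIdx)
      (fun x => tailSup_last finIdx_injective _ finIdx_le) (tailSup_idx finIdx_injective _)
      hcost (fun x hx => ?_) (fun K x y hx hy => ?_)
    · exact mem_of_valueRule' hJ (Or.inr (Or.inr (Or.inl ⟨rfl, .manmax₁ x⟩))) rfl
        (by simpa using hx)
    · rcases le_or_gt y x with h | h
      · rw [max_eq_left h]
        exact mem_of_valueRule' hJ (Or.inr (Or.inr (Or.inl ⟨rfl, .manmax₂ (K + 1) K x y h rfl⟩)))
          rfl (by rintro _ (rfl | rfl) <;> assumption)
      · rw [max_eq_right h.le]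
        exact mem_of_valueRule' hJ (Or.inr (Or.inr (Or.inl ⟨rfl, .manmax₃ (K + 1) K x y h rfl⟩)))
          rfl (by rintro _ (rfl | rfl) <;> assumption)

theorem womanValueAtom'_mem (hp : 0 < p) (hsat : sat ∉ J) (hc : c ≠ .singles) :
    womanValueAtom' c (groupValue c (womanCost P κ (acceptedPairs' J))) ∈ J := by
  have hcost := womancost'_mem hJ hsat hc
  have hsum : c = .sexeq ∨ c = .weight →
      womanweight' (∑ i, womanCost P κ (acceptedPairs' J) i) ∈ J := by
    intro hc'
    refine mem_of_valueRule' hJ (Or.inr (Or.inl ⟨hc', .womanweight _⟩)) rfl ?_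
    rw [← tailSum_one one_le_finIdx, Set.singleton_subset_iff]
    refine derive_tail (s := fun a z => womansum' a z ∈ J) (c := fun a z => womancost' a z ∈ J)
      (op := (· + ·)) hp (fun a => exists_finIdx)
      (fun x => tailSum_last finIdx_injective _ finIdx_le) (tailSum_idx finIdx_injective _)
      hcost (fun x hx => ?_) (fun K x y hx hy => ?_)
    · exact mem_of_valueRule' hJ (Or.inr (Or.inl ⟨hc', .womansum₁ x⟩)) rfl (by simpa using hx)
    · exact mem_of_valueRule' hJ (Or.inr (Or.inl ⟨hc', .womansum₂ (K + 1) K x y _ rfl rfl⟩)) rfl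
        (by rintro _ (rfl | rfl) <;> assumption)
  cases c with
  | singles => exact absurd rfl hc
  | sexeq => exact hsum (Or.inl rfl)
  | weight => exact hsum (Or.inr rfl)
  | regret =>
    refine mem_of_valueRule' hJ (Or.inr (Or.inr (Or.inl ⟨rfl, .womanregret _⟩))) rfl ?_
    rw [groupValue, ← tailSup_one one_le_finIdx, Set.singleton_subset_iff]
    refine derive_tail (s := fun a z => womanmax' a z ∈ J) (c := fun a z => womancost' a z ∈ J)
      (op := max) hp (fun a => exists_finIdx)
      (fun x => tailSup_last finIdx_injective _ finIdx_le) (tailSup_idx finIdx_injective _)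
      hcost (fun x hx => ?_) (fun K x y hx hy => ?_)
    · exact mem_of_valueRule' hJ (Or.inr (Or.inr (Or.inl ⟨rfl, .womanmax₁ x⟩))) rfl
        (by simpa using hx)
    · rcases le_or_gt y x with h | h
      · rw [max_eq_left h]
        exact mem_of_valueRule' hJ
          (Or.inr (Or.inr (Or.inl ⟨rfl, .womanmax₂ (K + 1) K x y h rfl⟩)))
          rfl (by rintro _ (rfl | rfl) <;> assumption)
      · rw [max_eq_right h.le]
        exact mem_of_valueRule' hJ
          (Or.inr (Or.inr (Or.inl ⟨rfl, .womanmax₃ (K + 1) K x y h rfl⟩)))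
          rfl (by rintro _ (rfl | rfl) <;> assumption)

/-- The value `0` in the count is triggered by `naccept'`, not by the absence of `accept'`. Someone
who is not single has an accepted partner, and the clause excluding both then leaves only
`naccept'`. -/
theorem naccept'_single_mem (hsat : sat ∉ J) {x : Person n p} (hx : (x, x) ∉ acceptedPairs' J) :
    naccept' x x ∈ J := by
  have hA := isCandidate_acceptedPairs' hJ hsat
  rcases x with i | j
  · rw [hA.manSingle i] at hx
    push Not at hx
    obtain ⟨k, hk, hkA⟩ := hx
    obtain ⟨_, rfl | rfl, h'⟩ := exists_mem_of_disjRule' hJ (.manSingle₂ i k hk)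
    · exact h'
    · exact absurd h' (not_naccept_couple' hJ hsat (mem_couple'.mp hkA))
  · rw [hA.womanSingle j] at hx
    push Not at hx
    obtain ⟨k, hk, hkA⟩ := hx
    obtain ⟨_, rfl | rfl, h'⟩ := exists_mem_of_disjRule' hJ (.womanSingle₂ k j hk)
    · exact h'
    · exact absurd h' (not_naccept_couple' hJ hsat (mem_couple'.mp hkA))

theorem single'_mem (hsat : sat ∉ J) (hc : c = .singles) (x : Person n p) :
    single' (personIdx x) (singleCost (acceptedPairs' J) x) ∈ J := by
  have rule : ∀ {r : Rule (Atom n p)}, SinglesRule' r → ValueRule' P κ c r :=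
    fun h => Or.inr (Or.inr (Or.inr (Or.inl ⟨hc, h⟩)))
  by_cases hx : (x, x) ∈ acceptedPairs' J
  · have hx' := mem_single'.mp hx
    rw [singleCost, if_pos hx]
    rcases x with i | j
    · exact mem_of_valueRule' hJ (rule (.man₁ i)) rfl (by simpa using hx')
    · exact mem_of_valueRule' hJ (rule (.woman₁ j)) rfl (by simpa using hx')
  · have hx' := naccept'_single_mem hJ hsat hx
    rw [singleCost, if_neg hx]
    rcases x with i | j
    · exact mem_of_valueRule' hJ (rule (.man₀ i)) rfl (by simpa using hx')
    · exact mem_of_valueRule' hJ (rule (.woman₀ j)) rfl (by simpa using hx')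

/-- `J` may contain further `crit'` values, as it need not be minimal; a single correct one is
enough to trigger the comparison rule. -/
theorem crit'_mem (hn : 0 < n) (hp : 0 < p) (hsat : sat ∉ J) :
    crit' c (critCost P κ c (acceptedPairs' J)) ∈ J := by
  by_cases hc : c = .singles
  · have rule : ∀ {r : Rule (Atom n p)}, SinglesRule' r → ValueRule' P κ c r :=
      fun h => Or.inr (Or.inr (Or.inr (Or.inl ⟨hc, h⟩)))
    refine mem_of_valueRule' hJ (rule (.singles _)) (by rw [hc]) ?_
    rw [critCost_singles, ← tailSum_one one_le_personIdx, Set.singleton_subset_iff]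
    refine derive_tail (s := fun a z => singlesum' a z ∈ J) (c := fun a z => single' a z ∈ J)
      -- Men and women are counted in one list, women numbered `1` to `p` and men `p + 1` to `n +
      -- p`.
      (op := (· + ·)) (N := n + p) (by omega) (fun a => exists_personIdx)
      (fun x => tailSum_last personIdx_injective _ personIdx_le)
      (tailSum_idx personIdx_injective _)
      (single'_mem hJ hsat hc) (fun x hx => ?_) (fun K x y hx hy => ?_)
    · exact mem_of_valueRule' hJ (rule (.singlesum₁ x)) rfl (by simpa using hx)
    · exact mem_of_valueRule' hJ (rule (.singlesum₂ (K + 1) K x y _ rfl rfl)) rfl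
        (by rintro _ (rfl | rfl) <;> assumption)
  · rw [critCost_eq_combine P κ hc]
    refine mem_of_valueRule' hJ (Or.inr (Or.inr (Or.inr (Or.inr ⟨hc, _, _, rfl⟩)))) rfl ?_
    rintro _ (rfl | rfl)
    exacts [manValueAtom'_mem hJ hn hsat hc, womanValueAtom'_mem hJ hp hsat hc]

end Model

/-! ## Answer sets and optimal stable sets of marriages -/

section Main

variable {P : Instance n p} {κ : CostConvention} {c : Criterion} {I : Set (Atom n p)}

/-! ### From answer sets to optimal stable sets -/

theorem not_unprimed_of_mem_head {r : Rule (Atom n p)}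
    (hr : r ∈ extProgram' P κ c ∪ {r | SatRule c r}) {a : Atom n p} (ha : a ∈ r.head) :
    ¬ Unprimed a := by
  rcases hr with hr | hr
  · rcases mem_extProgram'.mp hr with h | h | h
    · exact h.not_unprimed a ha
    · rw [h.head_body.1] at ha
      obtain rfl := Set.mem_singleton_iff.mp ha
      exact id
    · obtain ⟨b, hb, hbu, -⟩ := h.head_body
      rw [hb] at ha
      exact ha ▸ hbu
  · rcases SatRule.cases_head hr with ⟨x, y, -, rfl⟩ | rfl | ⟨b, hb, hbu, -⟩
    · obtain rfl := Set.mem_singleton_iff.mp ha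
      exact id
    · exact absurd ha (Set.notMem_empty a)
    · rw [hb] at ha
      exact ha ▸ hbu

theorem IsAnswerSet.isCompletion (h : IsAnswerSet (critProgram P κ c) I) :
    IsCompletion P κ c I := by
  intro a ha
  constructor
  · intro haI
    obtain ⟨r, hr, har, hneg, hagg, hpos⟩ := h.supported haI
    rcases hr with (hr | hr) | hr
    · obtain ⟨b, hb, -⟩ := level_lt hr
      refine ⟨r, hr, ?_, hneg, hagg, hpos⟩
      rw [hb] at har ⊢
      rw [Set.mem_singleton_iff.mp har]
    · exact absurd ha (not_unprimed_of_mem_head (c := c) (P := P) (κ := κ) (Or.inl hr) har)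
    · exact absurd ha (not_unprimed_of_mem_head (c := c) (P := P) (κ := κ) (Or.inr hr) har)
  · rintro ⟨r, hr, hhead, hneg, hagg, hpos⟩
    obtain ⟨b, hb, hbI⟩ := h.model (Or.inl (Or.inl hr)) hneg hagg hpos
    rw [hhead] at hb
    exact hb ▸ hbI

/-- Without `sat` the constraint would survive in the reduct with an empty head. -/
theorem IsAnswerSet.sat_mem (h : IsAnswerSet (critProgram P κ c) I) : sat ∈ I := by
  by_contra hsat
  obtain ⟨a, ha, -⟩ := h.model (Or.inr SatRule.notSat)
    (by rw [Set.singleton_inter_eq_empty]; exact hsat) trivial (Set.empty_subset _)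
  exact ha

theorem extProgram'_union_satRule_subset :
    extProgram' P κ c ∪ {r | SatRule c r} ⊆ critProgram P κ c := by
  rintro r (hr | hr)
  exacts [Or.inl (Or.inr hr), Or.inr hr]

theorem IsAnswerSet.isOptimal (h : IsAnswerSet (critProgram P κ c) I) (hn : 0 < n) (hp : 0 < p) :
    IsOptimal P κ c (acceptedPairs I) := by
  have hcomp := h.isCompletion
  refine ⟨hcomp.isCandidate.isStable, fun T hT => ?_⟩
  by_contra hlt
  rw [not_le] at hlt
  have hTc := hT.isCandidate
  -- A strictly better `T` shrinks `I`: keep the first candidate and the facts, and from the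
  -- saturated primed atoms retain those true for `T`.
  refine h.2 (I ∩ {a | comparisonAtoms P κ T a}) ?_ ?_
  · refine Set.inter_subset_left.ssubset_of_not_subset fun hsub => ?_
    exact (hsub h.sat_mem).2
  · rw [isModel_reduct_iff]
    intro r hr hneg hagg hpos _
    have hposI : r.pos ⊆ I := hpos.trans Set.inter_subset_left
    have hposD : ∀ b ∈ r.pos, comparisonAtoms P κ T b := fun b hb => (hpos hb).2
    obtain ⟨a, ha, haI⟩ := h.model hr hneg hagg hposI
    rcases hr with (hr | hr) | hr
    · obtain ⟨b, hb, hbu, -⟩ := level_lt hr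
      refine ⟨a, ha, haI, comparisonAtoms_of_unprimed ?_⟩
      rw [hb] at ha
      rwa [Set.mem_singleton_iff.mp ha]
    · rcases mem_extProgram'.mp hr with hr | hr | hr
      -- The head atom satisfied by `I` may be false for `T`; the one true for `T` lies in `I` by
      -- saturation.
      · obtain ⟨b, hb, hbD⟩ := hr.comparison (κ := κ) hTc
        exact ⟨b, hb, (hr.saturated_head b hb).mem extProgram'_union_satRule_subset h.1
          (Set.singleton_subset_iff.mpr h.sat_mem), hbD⟩
      · exact (hr.comparison hposD).elim
      · exact ⟨a, ha, haI, hr.comparison hTc.isMarriages hposD a ha⟩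
    · rcases SatRule.cases_head hr with ⟨x, y, hxy, rfl⟩ | rfl | ⟨b, hb, -, -, -, -, hfact⟩
      -- The comparison rule would need the value of `I` to be at most that of `T`, contrary to the
      -- choice of `T`.
      · have hx := (hcomp.crit_iff hn hp x).mp (hposI (Or.inl rfl))
        have hy : y = critCost P κ c T := hposD _ (Or.inr rfl)
        omega
      · exact absurd ha (Set.notMem_empty a)
      · refine ⟨a, ha, haI, ?_⟩
        rw [hb] at ha
        obtain rfl := Set.mem_singleton_iff.mp ha
        rcases hfact with hs | ⟨_, rfl⟩ | ⟨_, rfl⟩ | ⟨_, rfl⟩ | ⟨_, rfl⟩ | ⟨_, rfl⟩ | ⟨_, rfl⟩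
        · exact (hposD _ hs).elim
        all_goals trivial

/-- The answer set for an optimal stable set of marriages `A`. -/
def optimalAnswerSet (P : Instance n p) (κ : CostConvention) (c : Criterion)
    (A : Set (Person n p × Person n p)) : Set (Atom n p) :=
  {a | (Unprimed a ∧ candidateAtoms P κ c A a) ∨ Saturated P κ c a}

/-! ### From optimal stable sets to answer sets -/

theorem mem_optimalAnswerSet_of_unprimed {A : Set (Person n p × Person n p)} {a : Atom n p}
    (h : Unprimed a) : a ∈ optimalAnswerSet P κ c A ↔ candidateAtoms P κ c A a :=
  ⟨fun ha => ha.elim And.right fun hs => absurd h hs.not_unprimed, fun ha => Or.inl ⟨h, ha⟩⟩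

theorem saturated_of_mem_optimalAnswerSet {A : Set (Person n p × Person n p)} {a : Atom n p}
    (h : ¬ Unprimed a) (ha : a ∈ optimalAnswerSet P κ c A) : Saturated P κ c a :=
  ha.elim (fun h' => absurd h'.1 h) id

theorem acceptedPairs_optimalAnswerSet (A : Set (Person n p × Person n p)) :
    acceptedPairs (optimalAnswerSet P κ c A) = A := by
  ext ⟨x, y⟩
  exact mem_optimalAnswerSet_of_unprimed (a := accept x y) trivial

theorem isModel_optimalAnswerSet {A : Set (Person n p × Person n p)}
    (hcomp : IsCompletion P κ c (optimalAnswerSet P κ c A)) :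
    IsModel (reduct (critProgram P κ c) (optimalAnswerSet P κ c A))
      (optimalAnswerSet P κ c A) := by
  rw [isModel_reduct_iff]
  intro r hr hneg hagg hpos _
  rcases hr with (hr | hr) | hr
  · obtain ⟨b, hb, hbu, -⟩ := level_lt hr
    exact ⟨b, hb ▸ rfl, (hcomp b hbu).mpr ⟨r, hr, hb, hneg, hagg, hpos⟩⟩
  · rcases mem_extProgram'.mp hr with hr' | hr' | hr'
    -- Any head atom will do, since all of them are saturated; only nonemptiness of the head
    -- matters.
    · obtain ⟨b, hb, -⟩ : ∃ b ∈ r.head, True := by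
        cases hr' <;> simp
      exact ⟨b, hb, Or.inr (hr'.saturated_head b hb)⟩
    · exact ⟨sat, by rw [hr'.head_body.1]; rfl, Or.inr saturated_sat⟩
    · obtain ⟨b, hb, -, hneg', hagg', hpos'⟩ := hr'.head_body
      exact ⟨b, hb ▸ rfl, Or.inr (Consequence.step (Or.inl hr) hb hneg' hagg' fun e he =>
        saturated_of_mem_optimalAnswerSet (hpos' e he) (hpos he))⟩
  · rcases SatRule.cases_head hr with ⟨x, y, -, rfl⟩ | rfl | ⟨b, hb, -, hneg', hagg', hpos', -⟩
    · exact ⟨sat, rfl, Or.inr saturated_sat⟩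
    · rw [Set.singleton_inter_eq_empty] at hneg
      exact absurd (Or.inr saturated_sat) hneg
    · exact ⟨b, hb ▸ rfl, Or.inr (Consequence.step (Or.inr hr) hb hneg' hagg' fun e he =>
        saturated_of_mem_optimalAnswerSet (hpos' e he) (hpos he))⟩

theorem IsOptimal.isAnswerSet {A : Set (Person n p × Person n p)} (hA : IsOptimal P κ c A)
    (hn : 0 < n) (hp : 0 < p) :
    IsAnswerSet (critProgram P κ c) (optimalAnswerSet P κ c A) := by
  have hcomp : IsCompletion P κ c (optimalAnswerSet P κ c A) :=
    isCompletion_of_candidateAtoms hn hp hA.1.isCandidate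
      fun a ha => mem_optimalAnswerSet_of_unprimed ha
  refine ⟨isModel_optimalAnswerSet hcomp, fun J hJI hJ => hJI.2 ?_⟩
  have hunprimed := hcomp.mem_of_isModel (Set.subset_union_left.trans Set.subset_union_left)
    hJI.1 hJ
  -- The only use of optimality: a model `J` without `sat` encodes a stable set no better than `A`,
  -- so the comparison rule puts `sat` into `J`.
  have hsat : sat ∈ J := by
    by_contra hsat
    have hmod : ∀ r ∈ extProgram' P κ c, r.pos ⊆ J → ∃ a ∈ r.head, a ∈ J := by
      intro r hr hpos
      have hbody : r.neg = ∅ ∧ ∀ X, r.agg X := by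
        rcases mem_extProgram'.mp hr with h | h | h
        · exact ⟨h.body.1, h.body.2.1⟩
        · exact ⟨h.head_body.2.1, h.head_body.2.2.1⟩
        · obtain ⟨b, -, -, h1, h2, -⟩ := h.head_body
          exact ⟨h1, h2⟩
      exact isModel_reduct_iff.mp hJ r (Or.inl (Or.inr hr)) (by simp [hbody.1]) (hbody.2 _) hpos
        (hbody.2 _)
    have hT := (isCandidate_acceptedPairs' hmod hsat).isStable
    have hcrit : crit c (critCost P κ c A) ∈ J := by
      refine hunprimed _ trivial ((hcomp.crit_iff hn hp _).mpr ?_)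
      rw [acceptedPairs_optimalAnswerSet]
    obtain ⟨a, ha, haJ⟩ := isModel_reduct_iff.mp hJ _
      (Or.inr (SatRule.compare _ _ (hA.2 _ hT))) (Set.empty_inter _) trivial
      (by rintro _ (rfl | rfl); exacts [hcrit, crit'_mem hmod hn hp hsat]) trivial
    obtain rfl := Set.mem_singleton_iff.mp ha
    exact hsat haJ
  -- With `sat` in `J` the whole definite closure is in `J`, so `J` is not a proper subset.
  rintro a (⟨hu, ha⟩ | ha)
  · exact hunprimed a hu (Or.inl ⟨hu, ha⟩)
  · exact ha.mem extProgram'_union_satRule_subset hJ (Set.singleton_subset_iff.mpr hsat)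

end Main

end StableASP

open StableASP
theorem proposition3 {n p : ℕ} (hn : 0 < n) (hp : 0 < p) (P : Instance n p)
    (κ : CostConvention) (c : Criterion) :
    (∀ I : Set (Atom n p), IsAnswerSet (critProgram P κ c) I →
      IsOptimal P κ c (acceptedPairs I) ∧
      ∀ v : ℕ, Atom.crit c v ∈ I ↔ v = critCost P κ c (acceptedPairs I)) ∧
    (∀ S : Set (Person n p × Person n p), IsOptimal P κ c S →
      ∃ I : Set (Atom n p), IsAnswerSet (critProgram P κ c) I ∧
        acceptedPairs I = S ∧
        ∀ v : ℕ, Atom.crit c v ∈ I ↔ v = critCost P κ c S) := by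
  refine ⟨fun I hI => ⟨hI.isOptimal hn hp, hI.isCompletion.crit_iff hn hp⟩, fun S hS => ?_⟩
  have hI := hS.isAnswerSet hn hp
  refine ⟨_, hI, acceptedPairs_optimalAnswerSet S, fun v => ?_⟩
  rw [hI.isCompletion.crit_iff hn hp, acceptedPairs_optimalAnswerSet]
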